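/- Let $L\ge 1$ be an integer (the number of RIS elements), $0<R_1<R_2$, $\delta>0$, $\bar\gamma_B,\bar\gamma_E>0$, $R_t\ge 0$, and put $R_s=2^{R_t}$, $W=R_s-1$. Let $\epsilon_B,\epsilon_E$ be random variables with the circularly symmetric complex Gaussian law $\mathcal{CN}(0,L)$ and let Eve's position $X$ be uniformly distributed in the planar ring $\{x\in\mathbb R^2: R_1\le\|x\|\le R_2\}$ centred at the RIS, with $\epsilon_B,\epsilon_E,X$ mutually independent (random discrete phase shifting in the large-$L$ Gaussian model). Let the SNRs of Bob and Eve be $$\gamma_B=\bar\gamma_B|\epsilon_B|^2,\qquad \gamma_E=\bar\gamma_E|\epsilon_E|^2/\|X\|^{\delta},$$ and let $C_s=[\log_2(1+\gamma_B)-\log_2(1+\gamma_E)]^+$ be the secrecy capacity. The secrecy outage probability (SOP), its lower bound, and the probability of non-zero secrecy capacity (PNZ) are $$\mathcal P_{out}^{D}=\Pr(C_s\le R_t),\qquad \mathcal P_{out}^{D,L}=\Pr(\gamma_B\le R_s\gamma_E),\qquad \mathcal P_{nz}^{D}=\Pr(C_s>0).$$ Write $\boldsymbol\gamma(a,x)=\int_0^x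 t^{a-1}e^{-t}\,dt$ for the lower incomplete Gamma function and $G^{m,n}_{p,q}$ for Meijer's $G$-function, given by the Mellin–Barnes integral $$G^{m,n}_{p,q}\!\left[z\,\Big|\,{a_1,\dots,a_p\atop b_1,\dots,b_q}\right]=\frac1{2\pi i}\int\frac{\prod_{j=1}^m\Gamma(b_j-s)\prod_{j=1}^n\Gamma(1-a_j+s)}{\prod_{j=m+1}^q\Gamma(1-b_j+s)\prod_{j=n+1}^p\Gamma(a_j-s)}\,z^s\,ds$$ along an upward vertical line with the poles of $\Gamma(b_j-s)$, $j\le m$, to its right and those of $\Gamma(1-a_j+s)$, $j\le n$, to its left. Then: 1. $\gamma_B$ is exponentially distributed with mean $L\bar\gamma_B$. 2. $\gamma_E$ has the density, supported on $\gamma>0$, $$f_E^D(\gamma)=\frac{2}{\delta L\bar\gamma_E(R_2^2-R_1^2)}\Big(\frac{L\bar\gamma_E}{\gamma}\Big)^{1+\frac2\delta}\Big[\boldsymbol\gamma\Big(1+\tfrac2\delta,\tfrac{R_2^\delta\gamma}{L\bar\gamma_E}\Big)-\boldsymbol\gamma\Big(1+\tfrac2\delta,\tfrac{R_1^\delta\gamma}{L\bar\gamma_E}\Big)\Big]$$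 and, for $\gamma>0$, the distribution function $$F_E^D(\gamma)=1-\frac{2}{\delta(R_2^2-R_1^2)}\Big(\frac{L\bar\gamma_E}{\gamma}\Big)^{\frac2\delta}\Big[\boldsymbol\gamma\Big(\tfrac2\delta,\tfrac{R_2^\delta\gamma}{L\bar\gamma_E}\Big)-\boldsymbol\gamma\Big(\tfrac2\delta,\tfrac{R_1^\delta\gamma}{L\bar\gamma_E}\Big)\Big].$$ 3. With $$D=G^{1,2}_{2,2}\!\left[\frac{R_2^\delta\bar\gamma_B}{R_s\bar\gamma_E}\,\Big|\,{1+\frac2\delta,\,1\atop 1+\frac2\delta,\,0}\right]-G^{1,2}_{2,2}\!\left[\frac{R_1^\delta\bar\gamma_B}{R_s\bar\gamma_E}\,\Big|\,{1+\frac2\delta,\,1\atop 1+\frac2\delta,\,0}\right],$$ one has, with a convergent series, $$\mathcal P_{out}^{D}=1-\frac{2}{\delta(R_2^2-R_1^2)}\Big(\frac{R_s\bar\gamma_E}{\bar\gamma_B}\Big)^{\frac2\delta}\sum_{k=0}^\infty\frac1{k!}\Big(-\frac{W}{L\bar\gamma_B}\Big)^kD .$$ 4. $\mathcal P_{out}^{D,L}\le\mathcal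 P_{out}^{D}$ and $$\mathcal P_{out}^{D,L}=1-\frac{2}{\delta(R_2^2-R_1^2)}\Big(\frac{R_s\bar\gamma_E}{\bar\gamma_B}\Big)^{\frac2\delta}D .$$ 5. $$\mathcal P_{nz}^{D}=1-\frac{2}{\delta(R_2^2-R_1^2)}\Big(\frac{\bar\gamma_E}{\bar\gamma_B}\Big)^{\frac2\delta}\left(G^{1,2}_{2,2}\!\left[\frac{R_2^\delta\bar\gamma_B}{\bar\gamma_E}\,\Big|\,{\frac2\delta,\,1\atop\frac2\delta,\,0}\right]-G^{1,2}_{2,2}\!\left[\frac{R_1^\delta\bar\gamma_B}{\bar\gamma_E}\,\Big|\,{\frac2\delta,\,1\atop\frac2\delta,\,0}\right]\right).$$ 6. $\mathcal P_{out}^{D,L}$ and $\mathcal P_{nz}^{D}$ do not depend on $L$: they take the same values for any other number $L'\ge1$ of elements. -/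

import Mathlib

open MeasureTheory ProbabilityTheory

universe u

noncomputable section

/-- The lower incomplete Gamma function `γ(a, x) = ∫₀ˣ t^(a-1) e^(-t) dt`. -/
def lowerGamma (a x : ℝ) : ℝ := ∫ t in (0 : ℝ)..x, t ^ (a - 1) * Real.exp (-t)

/-- The Mellin-Barnes integrand of Meijer's `G`-function `G_{p,q}^{m,n}[z | a; b]`:
`∏_{j ≤ m} Γ(b_j - s) ∏_{j ≤ n} Γ(1 - a_j + s) / (∏_{j > m} Γ(1 - b_j + s) ∏_{j > n} Γ(a_j - s)) * z^s`
(with indices counted from `0` here). At the poles of a Gamma function in the denominator, Mathlib's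
value of that Gamma function is `0`, so that the quotient is `0`, as it should be. -/
def meijerIntegrand (m n : ℕ) {p q : ℕ} (a : Fin p → ℂ) (b : Fin q → ℂ) (z s : ℂ) : ℂ :=
  ((∏ j ∈ Finset.univ.filter (fun j : Fin q => (j : ℕ) < m), Complex.Gamma (b j - s)) *
      ∏ j ∈ Finset.univ.filter (fun j : Fin p => (j : ℕ) < n), Complex.Gamma (1 - a j + s)) /
    ((∏ j ∈ Finset.univ.filter (fun j : Fin q => m ≤ (j : ℕ)), Complex.Gamma (1 - b j + s)) *
      ∏ j ∈ Finset.univ.filter (fun j : Fin p => n ≤ (j : ℕ)), Complex.Gamma (a j - s)) * z ^ s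

/-- The vertical line `Re s = σ` separates the poles: those of `Γ(b_j - s)`, `j ≤ m`, that is
`s = b_j + k`, lie to its right, and those of `Γ(1 - a_j + s)`, `j ≤ n`, that is
`s = a_j - 1 - k`, lie to its left (`k = 0, 1, 2, …`). -/
def MeijerSeparates (m n : ℕ) {p q : ℕ} (a : Fin p → ℂ) (b : Fin q → ℂ) (σ : ℝ) : Prop :=
  (∀ j : Fin q, (j : ℕ) < m → ∀ k : ℕ, σ < (b j + k).re) ∧
    (∀ j : Fin p, (j : ℕ) < n → ∀ k : ℕ, (a j - 1 - k).re < σ)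

open Classical in
/-- Meijer's `G`-function `G_{p,q}^{m,n}[z | a; b]`, by its Mellin-Barnes integral
`(2πi)⁻¹ ∫ meijerIntegrand ds` over a vertical line from `σ - i∞` to `σ + i∞` that separates the two
families of poles. (By Cauchy's theorem the choice of the line does not matter; parameters for
which no straight line separates the poles are given the value `0`.) -/
def meijerG (m n : ℕ) {p q : ℕ} (a : Fin p → ℂ) (b : Fin q → ℂ) (z : ℂ) : ℂ :=
  if h : ∃ σ : ℝ, MeijerSeparates m n a b σ then
    (1 / (2 * Real.pi) : ℂ) *
      ∫ t : ℝ, meijerIntegrand m n a b z ((h.choose : ℂ) + (t : ℂ) * Complex.I)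
  else 0

/-- The circularly symmetric complex Gaussian law `CN(0, v)`: real and imaginary part are
independent, centred, real Gaussian variables of variance `v / 2`. -/
def complexGaussian (v : NNReal) : Measure ℂ :=
  ((gaussianReal 0 (v / 2)).prod (gaussianReal 0 (v / 2))).map
    (fun p : ℝ × ℝ => (p.1 : ℂ) + (p.2 : ℂ) * Complex.I)

/-- The closed ring `R₁ ≤ ‖x‖ ≤ R₂` around the RIS, which sits at the origin of the plane. -/
def eveRing (R₁ R₂ : ℝ) : Set (EuclideanSpace ℝ (Fin 2)) := {x | R₁ ≤ ‖x‖ ∧ ‖x‖ ≤ R₂}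

/-- The Gaussian model of random discrete phase shifting with `L` reflecting elements: the overall
RIS fading coefficients `εB` (of Bob) and `εE` (of Eve) have the law `CN(0, L)`, Eve's position `X`
is uniformly distributed in the ring, and `εB`, `εE`, `X` are mutually independent. -/
structure IsDiscretePhaseModel (L : ℕ) (R₁ R₂ : ℝ) {Ω : Type*} [MeasurableSpace Ω]
    (P : Measure Ω) (εB εE : Ω → ℂ) (X : Ω → EuclideanSpace ℝ (Fin 2)) : Prop where
  measurable_bob : Measurable εB
  measurable_eve : Measurable εE
  measurable_pos : Measurable X
  law_bob : P.map εB = complexGaussian (L : NNReal)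
  law_eve : P.map εE = complexGaussian (L : NNReal)
  law_pos : pdf.IsUniform X (eveRing R₁ R₂) P volume
  indep_eve_pos : IndepFun εE X P
  indep_bob : IndepFun εB (fun ω => (εE ω, X ω)) P

/-- Bob's SNR `γ̄_B |ε_B|²`. -/
def bobSNR {Ω : Type*} (gB : ℝ) (εB : Ω → ℂ) (ω : Ω) : ℝ := gB * ‖εB ω‖ ^ 2

/-- Eve's SNR `γ̄_E |ε_E|² / d^δ`, where `d` is her distance from the RIS. -/
def eveSNR {Ω : Type*} (gE δ : ℝ) (εE : Ω → ℂ) (X : Ω → EuclideanSpace ℝ (Fin 2)) (ω : Ω) : ℝ :=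
  gE * ‖εE ω‖ ^ 2 / ‖X ω‖ ^ δ

/-- The instantaneous secrecy capacity `[log₂(1 + γ_B) - log₂(1 + γ_E)]⁺`. -/
def secrecyCapacity {Ω : Type*} (γB γE : Ω → ℝ) (ω : Ω) : ℝ :=
  max (Real.logb 2 (1 + γB ω) - Real.logb 2 (1 + γE ω)) 0

/-- The secrecy outage probability: the probability that the secrecy capacity does not exceed the
target secrecy rate `Rt`. -/
def secrecyOutageProb {Ω : Type*} [MeasurableSpace Ω] (P : Measure Ω) (γB γE : Ω → ℝ)
    (Rt : ℝ) : ℝ :=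
  P.real {ω | secrecyCapacity γB γE ω ≤ Rt}

/-- The lower bound of the secrecy outage probability: the probability that `γ_B ≤ R_s γ_E`, with
`R_s = 2^Rt` (obtained from `γ_B ≤ R_s γ_E + W`, `W = R_s - 1`, by dropping `W`). -/
def secrecyOutageLowerProb {Ω : Type*} [MeasurableSpace Ω] (P : Measure Ω) (γB γE : Ω → ℝ)
    (Rt : ℝ) : ℝ :=
  P.real {ω | γB ω ≤ (2 : ℝ) ^ Rt * γE ω}

/-- The probability of non-zero secrecy capacity. -/
def nonzeroSecrecyProb {Ω : Type*} [MeasurableSpace Ω] (P : Measure Ω) (γB γE : Ω → ℝ) : ℝ :=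
  P.real {ω | 0 < secrecyCapacity γB γE ω}

end

/-! The squared modulus of a `CN(0, L)` variable is exponential with mean `L`. Hence Bob's SNR is
exponential, and Eve's, given her position `x`, is exponential with rate `‖x‖ ^ δ / (L * gE)`. Every
quantity is therefore a radial average over the ring, and the substitution `u = c * r ^ δ`
(`integral_mul_comp_const_mul_rpow`) turns it into an integral of `u ^ (2 / δ - 1) * h u`.
Exponential `h`, with or without a factor `u`, gives the incomplete Gamma functions in the law of
Eve's SNR.

For the secrecy quantities, `measureReal_bobSNR_le` integrates Bob's exponential tail: `Pr(γ_B > a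
γ_E + w)` is `exp (-w / (L gB))` times the Laplace transform of `γ_E` at `a / (L gB)`. The latter is
the ring average of `z r^δ / (1 + z r^δ)` with `z = gB / (a gE)`. Here `L` cancels, so it survives
only in the factor carrying `w`; the cases `w = 0` do not depend on `L`, and expanding that factor
gives the series for the SOP.

What remains is `meijerG_eq_integral`: the `G`-function is an incomplete integral of `u ^ (a - 1) /
(1 + u)`. Since `Γ(s) / Γ(1 + s) = 1 / s`, its integrand is `Γ(a - s) Γ(1 - a + s) / s * z ^ s`,
whose Gamma quotient is the Mellin transform of `x ↦ ∫_0^{1/x} u ^ (a - 1) / (1 + u) du`. Mellin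
inversion at `1 / z` finishes, with absolute convergence coming from the reflection formula and the
growth of the sine on vertical lines. -/

/-! ### Mellin transforms -/

theorem integrableOn_rpow_mul_exp_neg_mul {s b : ℝ} (hs : 0 < s) (hb : 0 < b) :
    IntegrableOn (fun x : ℝ => x ^ (s - 1) * Real.exp (-(b * x))) (Set.Ioi 0) := by
  have := integrableOn_rpow_mul_exp_neg_mul_rpow (s := s - 1) (p := 1) (b := b)
    (by linarith) one_pos hb
  simpa using this

/-- The kernel whose two iterated integrals give the Mellin transform of `1 / (1 + u)`. -/
theorem integrable_cpow_mul_exp_neg_mul_one_add {p : ℂ} (h0 : 0 < p.re) (h1 : p.re < 1) :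
    Integrable (fun z : ℝ × ℝ => (z.1 : ℂ) ^ (p - 1) * (Real.exp (-(z.2 * (1 + z.1))) : ℂ))
      ((volume.restrict (Set.Ioi (0 : ℝ))).prod (volume.restrict (Set.Ioi (0 : ℝ)))) := by
  have hnorm : ∀ t : ℝ, ∀ u ∈ Set.Ioi (0 : ℝ),
      ‖(u : ℂ) ^ (p - 1) * (Real.exp (-(t * (1 + u))) : ℂ)‖ =
        Real.exp (-t) * (u ^ (p.re - 1) * Real.exp (-(t * u))) := by
    intro t u hu
    rw [norm_mul, Complex.norm_cpow_eq_rpow_re_of_pos hu, Complex.norm_real, Real.norm_eq_abs,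
      abs_of_pos (Real.exp_pos _), mul_left_comm, ← Real.exp_add]
    simp only [Complex.sub_re, Complex.one_re]
    ring_nf
  have hmeas : Measurable
      (fun z : ℝ × ℝ => (z.1 : ℂ) ^ (p - 1) * (Real.exp (-(z.2 * (1 + z.1))) : ℂ)) := by
    fun_prop
  rw [integrable_prod_iff' hmeas.aestronglyMeasurable]
  constructor
  · filter_upwards [ae_restrict_mem measurableSet_Ioi] with t ht
    rw [← integrable_norm_iff (by fun_prop)]
    refine (((integrableOn_rpow_mul_exp_neg_mul h0 ht).const_mul (Real.exp (-t))).congr ?_)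
    filter_upwards [ae_restrict_mem measurableSet_Ioi] with u hu
    exact (hnorm t u hu).symm
  -- Integrating the norm over `u` leaves `Γ(Re p) t ^ (-Re p) e ^ (-t)`; integrability at `0` is
  -- where `Re p < 1` enters.
  · have := (integrableOn_rpow_mul_exp_neg_mul (s := 1 - p.re) (b := 1) (by linarith)
      one_pos).const_mul (Real.Gamma p.re)
    refine this.congr ?_
    filter_upwards [ae_restrict_mem measurableSet_Ioi] with t ht
    rw [setIntegral_congr_fun measurableSet_Ioi (hnorm t), integral_const_mul,
      Real.integral_rpow_mul_exp_neg_mul_Ioi h0 ht, one_div, Real.inv_rpow (le_of_lt ht),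
      ← Real.rpow_neg (le_of_lt ht)]
    simp only [one_mul]
    ring_nf

/-- The Mellin transform of `1 / (1 + u)` in the strip `0 < Re p < 1`. -/
theorem hasMellin_one_div_one_add {p : ℂ} (h0 : 0 < p.re) (h1 : p.re < 1) :
    HasMellin (fun u : ℝ => ((1 / (1 + u) : ℝ) : ℂ)) p
      (Complex.Gamma p * Complex.Gamma (1 - p)) := by
  -- Fubini for `1 / (1 + u) = ∫ e ^ (-t (1 + u)) dt`: integrating over `u` first leaves `Γ(p) ∫ t ^
  -- (-p) e ^ (-t) dt`.
  have hF := integrable_cpow_mul_exp_neg_mul_one_add h0 h1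
  have hin : ∀ u ∈ Set.Ioi (0 : ℝ),
      (∫ t in Set.Ioi (0 : ℝ), (u : ℂ) ^ (p - 1) * (Real.exp (-(t * (1 + u))) : ℂ)) =
        (u : ℂ) ^ (p - 1) • ((1 / (1 + u) : ℝ) : ℂ) := by
    intro u hu
    have hu' : (0 : ℝ) < 1 + u := by
      have : (0 : ℝ) < u := hu
      linarith
    rw [integral_const_mul, integral_complex_ofReal, smul_eq_mul]
    congr 2
    have := integral_exp_mul_Ioi (a := -(1 + u)) (by linarith) 0
    simp only [mul_zero, Real.exp_zero] at this
    rw [neg_div_neg_eq] at this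
    rw [← this]
    refine setIntegral_congr_fun measurableSet_Ioi fun t _ => ?_
    congr 1
    ring
  constructor
  · refine hF.integral_prod_left.congr ?_
    filter_upwards [ae_restrict_mem measurableSet_Ioi] with u hu
    exact hin u hu
  · rw [mellin, ← setIntegral_congr_fun measurableSet_Ioi hin, integral_integral_swap hF]
    have hout : ∀ t ∈ Set.Ioi (0 : ℝ),
        (∫ u in Set.Ioi (0 : ℝ), (u : ℂ) ^ (p - 1) * (Real.exp (-(t * (1 + u))) : ℂ)) =
          Complex.Gamma p * ((t : ℂ) ^ ((1 - p) - 1) * Complex.exp (-((1 : ℝ) * t))) := by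
      intro t ht
      have ht' : (0 : ℝ) < t := ht
      have h := Complex.integral_cpow_mul_exp_neg_mul_Ioi (a := p) (r := t) h0 ht'
      have hsplit : ∀ u : ℝ, (u : ℂ) ^ (p - 1) * (Real.exp (-(t * (1 + u))) : ℂ) =
          Complex.exp (-t) * ((u : ℂ) ^ (p - 1) * Complex.exp (-(t * u))) := by
        intro u
        rw [mul_left_comm, ← Complex.exp_add]
        push_cast
        ring_nf
      simp_rw [hsplit]
      rw [integral_const_mul, h, one_div, Complex.inv_cpow _ _
        (by rw [Complex.arg_ofReal_of_nonneg ht'.le]; exact Real.pi_pos.ne),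
        ← Complex.cpow_neg, Complex.ofReal_one, one_mul]
      ring_nf
    rw [setIntegral_congr_fun measurableSet_Ioi hout, integral_const_mul,
      Complex.integral_cpow_mul_exp_neg_mul_Ioi (by simpa) one_pos]
    simp

/-- The kernel `1_{x u ≤ 1} x^(s-1) k(u)` is integrable if `k` has an absolutely convergent
Mellin integral. -/
theorem integrable_indicator_mul_cpow {s : ℂ} (hs : 0 < s.re) {k : ℝ → ℂ} (hk : Measurable k)
    (hint : IntegrableOn (fun u : ℝ => (u : ℂ) ^ (-s) * k u) (Set.Ioi 0)) :
    Integrable (fun z : ℝ × ℝ =>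
        (z.1 : ℂ) ^ (s - 1) * (Set.indicator (Set.Ioc (0 : ℝ) 1) 1 (z.2 * z.1) * k z.2))
      ((volume.restrict (Set.Ioi (0 : ℝ))).prod (volume.restrict (Set.Ioi (0 : ℝ)))) := by
  have hmeas : Measurable (fun z : ℝ × ℝ =>
      (z.1 : ℂ) ^ (s - 1) * (Set.indicator (Set.Ioc (0 : ℝ) 1) (1 : ℝ → ℂ) (z.2 * z.1) * k z.2)) := by
    have h1 : Measurable (Set.indicator (Set.Ioc (0 : ℝ) 1) (1 : ℝ → ℂ)) :=
      measurable_one.indicator measurableSet_Ioc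
    fun_prop
  rw [integrable_prod_iff' hmeas.aestronglyMeasurable]
  have hσ : 0 < ((s.re : ℝ) : ℂ).re := by simpa
  constructor
  · filter_upwards [ae_restrict_mem measurableSet_Ioi] with u hu
    have h1 := ((MellinConvergent.comp_mul_left hu).2 (hasMellin_one_Ioc hs).1)
    refine (h1.mul_const (k u)).congr (Filter.Eventually.of_forall fun x => ?_)
    simp only [smul_eq_mul, mul_assoc]
    rfl
  · refine (hint.norm.const_mul (1 / s.re)).congr ?_
    filter_upwards [ae_restrict_mem measurableSet_Ioi] with u hu
    have hu' : (0 : ℝ) < u := hu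
    -- The norm is cast to `ℂ` as a Mellin integrand at the real exponent `Re s`, so that the known
    -- transform of the indicator evaluates it.
    have h2 : ∀ x ∈ Set.Ioi (0 : ℝ),
        ((‖(x : ℂ) ^ (s - 1) * (Set.indicator (Set.Ioc (0 : ℝ) 1) (1 : ℝ → ℂ) (u * x) * k u)‖ : ℝ)
          : ℂ) = (x : ℂ) ^ ((s.re : ℂ) - 1) •
            (fun y => Set.indicator (Set.Ioc (0 : ℝ) 1) (fun _ => (1 : ℂ)) y) (u * x) *
              (‖k u‖ : ℂ) := by
      intro x hx
      have hx' : (0 : ℝ) < x := hx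
      rw [norm_mul, norm_mul, Complex.norm_cpow_eq_rpow_re_of_pos hx']
      push_cast
      rw [Complex.ofReal_cpow hx'.le]
      by_cases hm : u * x ∈ Set.Ioc (0 : ℝ) 1 <;> simp [hm]
    apply Complex.ofReal_injective
    rw [← integral_complex_ofReal, setIntegral_congr_fun measurableSet_Ioi h2, integral_mul_const]
    have h3 := mellin_comp_mul_left (Set.indicator (Set.Ioc (0 : ℝ) 1) (fun _ => (1 : ℂ)))
      (s.re : ℂ) hu'
    rw [(hasMellin_one_Ioc hσ).2] at h3
    rw [mellin] at h3
    rw [h3, norm_mul, Complex.norm_cpow_eq_rpow_re_of_pos hu']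
    push_cast
    rw [Complex.ofReal_cpow hu'.le]
    simp only [Complex.neg_re, Complex.ofReal_neg, smul_eq_mul]
    ring

/-- The Mellin transform of `x ↦ ∫_0^{1/x} k`. -/
theorem hasMellin_integral_inv {s : ℂ} (hs : 0 < s.re) {k : ℝ → ℂ} (hk : Measurable k)
    (hint : IntegrableOn (fun u : ℝ => (u : ℂ) ^ (-s) * k u) (Set.Ioi 0)) :
    HasMellin (fun x : ℝ => ∫ u in (0 : ℝ)..x⁻¹, k u) s
      ((∫ u in Set.Ioi (0 : ℝ), (u : ℂ) ^ (-s) * k u) / s) := by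
  -- The inner integral is one of `1_{u x ≤ 1} k(u)`; after swapping, the dilated indicator
  -- contributes `u ^ (-s) / s`.
  have hF := integrable_indicator_mul_cpow hs hk hint
  have hin : ∀ x ∈ Set.Ioi (0 : ℝ), (∫ u in Set.Ioi (0 : ℝ), (x : ℂ) ^ (s - 1) *
      (Set.indicator (Set.Ioc (0 : ℝ) 1) (1 : ℝ → ℂ) (u * x) * k u)) =
        (x : ℂ) ^ (s - 1) • ∫ u in (0 : ℝ)..x⁻¹, k u := by
    intro x hx
    have hx' : (0 : ℝ) < x := hx
    rw [integral_const_mul, smul_eq_mul, intervalIntegral.integral_of_le (by positivity)]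
    congr 1
    rw [← integral_indicator measurableSet_Ioi, ← integral_indicator measurableSet_Ioc]
    congr 1
    ext u
    by_cases hu : 0 < u
    · have h1 : u * x ∈ Set.Ioc (0 : ℝ) 1 ↔ u ∈ Set.Ioc (0 : ℝ) x⁻¹ := by
        simp only [Set.mem_Ioc, hu, mul_pos hu hx', true_and]
        rw [le_inv_comm₀ hu hx', inv_eq_one_div, le_div_iff₀ hu, mul_comm]
      by_cases hm : u ∈ Set.Ioc (0 : ℝ) x⁻¹
      · simp [h1.2 hm, hm, hu]
      · have : u * x ∉ Set.Ioc (0 : ℝ) 1 := fun h => hm (h1.1 h)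
        simp [this, hm, hu]
    · simp [hu]
  constructor
  · refine hF.integral_prod_left.congr ?_
    filter_upwards [ae_restrict_mem measurableSet_Ioi] with x hx
    exact hin x hx
  · rw [mellin, ← setIntegral_congr_fun measurableSet_Ioi hin, integral_integral_swap hF,
      ← integral_div]
    refine setIntegral_congr_fun measurableSet_Ioi fun u hu => ?_
    have hu' : (0 : ℝ) < u := hu
    have h3 := mellin_comp_mul_left (Set.indicator (Set.Ioc (0 : ℝ) 1) (fun _ => (1 : ℂ))) s hu'
    rw [(hasMellin_one_Ioc hs).2, mellin] at h3
    simp only [smul_eq_mul] at h3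
    simp_rw [← mul_assoc]
    rw [integral_mul_const]
    refine (congrArg (· * k u) h3).trans ?_
    ring

/-! ### Meijer's `G`-function as an incomplete integral -/

theorem intervalIntegrable_rpow_div_one_add {a z : ℝ} (ha : 0 < a) (hz : 0 < z) :
    IntervalIntegrable (fun u : ℝ => u ^ (a - 1) / (1 + u)) volume 0 z := by
  simp_rw [div_eq_mul_inv]
  refine (intervalIntegral.intervalIntegrable_rpow' (by linarith)).mul_continuousOn ?_
  refine ContinuousOn.inv₀ (by fun_prop) fun u hu => ?_
  rw [Set.uIcc_of_le hz.le] at hu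
  have := hu.1
  positivity

theorem one_add_sq_half_le_cosh (y : ℝ) : 1 + y ^ 2 / 2 ≤ Real.cosh y := by
  have h : Real.cosh y = 1 + 2 * Real.sinh (y / 2) ^ 2 := by
    have h1 := Real.cosh_two_mul (y / 2)
    rw [mul_div_cancel₀ _ (two_ne_zero), Real.cosh_sq] at h1
    linarith
  have h2 : (y / 2) ^ 2 ≤ Real.sinh (y / 2) ^ 2 := by
    rw [sq_le_sq, Real.abs_sinh]
    exact Real.self_le_sinh_iff.2 (abs_nonneg _)
  rw [h]
  nlinarith

/-- The real part of `sin (x + i y)` is `sin x * cosh y`. Quadratic growth in `y` suffices for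
integrability on a vertical line. -/
theorem sin_mul_one_add_sq_half_le_norm_sin {z : ℂ} (hx : 0 ≤ Real.sin z.re) :
    Real.sin z.re * (1 + z.im ^ 2 / 2) ≤ ‖Complex.sin z‖ := by
  have hre : (Complex.sin z).re = Real.sin z.re * Real.cosh z.im := by
    rw [Complex.sin_eq]
    simp [Complex.sin_ofReal_re, Complex.cosh_ofReal_re]
  calc _ ≤ Real.sin z.re * Real.cosh z.im :=
        mul_le_mul_of_nonneg_left (one_add_sq_half_le_cosh _) hx
    _ = (Complex.sin z).re := hre.symm
    _ ≤ _ := Complex.re_le_norm _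

/-- By reflection the function is `π / (sin (π (a - s)) * s)`. On the line, `π (a - s)` has real
part in `(0, π)`, so the sine bound gives domination by a multiple of `1 / (1 + y ^ 2)`. -/
theorem verticalIntegrable_Gamma_mul_Gamma_div {a σ : ℝ} (hσ : 0 < σ) (h1 : a - 1 < σ)
    (h2 : σ < a) :
    Complex.VerticalIntegrable
      (fun s : ℂ => Complex.Gamma (a - s) * Complex.Gamma (1 - (a - s)) / s) σ := by
  have hsin : 0 < Real.sin (Real.pi * (a - σ)) := by
    apply Real.sin_pos_of_pos_of_lt_pi
    · exact mul_pos Real.pi_pos (by linarith)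
    · nlinarith [Real.pi_pos]
  simp only [Complex.VerticalIntegrable, Complex.Gamma_mul_Gamma_one_sub]
  have hb : Integrable (fun y : ℝ => Real.pi / (Real.sin (Real.pi * (a - σ)) * σ) * (1 + y ^ 2)⁻¹) :=
    integrable_inv_one_add_sq.const_mul _
  refine hb.mono' (Measurable.aestronglyMeasurable (by fun_prop))
    (Filter.Eventually.of_forall fun y => ?_)
  have hs := sin_mul_one_add_sq_half_le_norm_sin (z := Real.pi * (a - (σ + y * Complex.I)))
    (by simpa using hsin.le)
  have hre : (Real.pi * (a - (σ + y * Complex.I)) : ℂ).re = Real.pi * (a - σ) := by simp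
  have him : (Real.pi * (a - (σ + y * Complex.I)) : ℂ).im = -(Real.pi * y) := by simp
  rw [hre, him] at hs
  have hsn : σ ≤ ‖(σ + y * Complex.I : ℂ)‖ := by
    simpa using Complex.re_le_norm (σ + y * Complex.I : ℂ)
  have hpi : (1 : ℝ) + y ^ 2 ≤ 1 + (-(Real.pi * y)) ^ 2 / 2 := by
    have : (2 : ℝ) ≤ Real.pi ^ 2 := by nlinarith [Real.pi_gt_three]
    nlinarith [sq_nonneg y, mul_le_mul_of_nonneg_right this (sq_nonneg y)]
  rw [norm_div, norm_div, Complex.norm_real, Real.norm_of_nonneg Real.pi_pos.le, div_div,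
    ← div_eq_mul_inv, div_div]
  apply div_le_div_of_nonneg_left Real.pi_pos.le (by positivity)
  calc _ = Real.sin (Real.pi * (a - σ)) * (1 + y ^ 2) * σ := by ring
    _ ≤ Real.sin (Real.pi * (a - σ)) * (1 + (-(Real.pi * y)) ^ 2 / 2) * σ := by gcongr
    _ ≤ _ := by gcongr

/-- Only the first pole of each family, `k = 0`, constrains the line. -/
theorem meijerSeparates_iff {a σ : ℝ} :
    MeijerSeparates 1 2 ![(a : ℂ), 1] ![(a : ℂ), 0] σ ↔ σ < a ∧ a - 1 < σ ∧ 0 < σ := by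
  constructor
  · rintro ⟨h1, h2⟩
    have e1 := h1 0 (by simp) 0
    have e2 := h2 0 (by simp) 0
    have e3 := h2 1 (by simp) 0
    simp at e1 e2 e3
    exact ⟨e1, e2, e3⟩
  · rintro ⟨h1, h2, h3⟩
    constructor
    · intro j hj k
      obtain rfl : j = 0 := by ext; simpa using hj
      have : (0 : ℝ) ≤ k := k.cast_nonneg
      simp
      linarith
    · intro j _ k
      have : (0 : ℝ) ≤ k := k.cast_nonneg
      fin_cases j <;> simp <;> linarith

theorem meijerIntegrand_one_two_two_two (a z : ℂ) {s : ℂ} (hs : 0 < s.re) :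
    meijerIntegrand 1 2 ![a, 1] ![a, 0] z s =
      Complex.Gamma (a - s) * Complex.Gamma (1 - (a - s)) / s * z ^ s := by
  have h0 : s ≠ 0 := fun h => by simp [h] at hs
  have hG : Complex.Gamma s ≠ 0 := Complex.Gamma_ne_zero_of_re_pos hs
  have h1 : 1 - a + s = 1 - (a - s) := by ring
  simp only [meijerIntegrand, Finset.prod_filter, Fin.prod_univ_two]
  simp [h1, add_comm (1 : ℂ) s, Complex.Gamma_add_one s h0]
  field_simp
  simp

/-- For `k(u) = u ^ (a - 1) / (1 + u)`, the integral of `u ^ (-s) * k(u)` is the Mellin transform of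
`1 / (1 + u)` at `a - s`, which must lie in the strip `0 < Re < 1`. -/
theorem hasMellin_integral_rpow_div_one_add {a : ℝ} {s : ℂ} (hs : 0 < s.re) (h1 : a - 1 < s.re)
    (h2 : s.re < a) :
    HasMellin (fun x : ℝ => ∫ u in (0 : ℝ)..x⁻¹, ((u ^ (a - 1) / (1 + u) : ℝ) : ℂ)) s
      (Complex.Gamma (a - s) * Complex.Gamma (1 - (a - s)) / s) := by
  have hM := hasMellin_one_div_one_add (p := a - s) (by simpa using h2)
    (by simp only [Complex.sub_re, Complex.ofReal_re]; linarith)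
  have hk : Measurable (fun u : ℝ => ((u ^ (a - 1) / (1 + u) : ℝ) : ℂ)) := by fun_prop
  have heq : ∀ u ∈ Set.Ioi (0 : ℝ), (u : ℂ) ^ ((a - s : ℂ) - 1) • ((1 / (1 + u) : ℝ) : ℂ) =
      (u : ℂ) ^ (-s) * ((u ^ (a - 1) / (1 + u) : ℝ) : ℂ) := by
    intro u hu
    have hu' : (0 : ℝ) < u := hu
    have hu0 : (u : ℂ) ≠ 0 := by exact_mod_cast hu'.ne'
    rw [show ((a - s : ℂ) - 1) = -s + ((a - 1 : ℝ) : ℂ) by push_cast; ring,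
      Complex.cpow_add _ _ hu0, ← Complex.ofReal_cpow hu'.le, smul_eq_mul]
    push_cast
    ring
  have := hasMellin_integral_inv hs hk ((integrableOn_congr_fun heq measurableSet_Ioi).1 hM.1)
  rwa [← setIntegral_congr_fun measurableSet_Ioi heq, ← mellin, hM.2] at this

/-- `G^{1,2}_{2,2}[z | a, 1; a, 0] = ∫_0^z u^(a-1) / (1 + u) du` for real `a > 0` and `z > 0`. -/
theorem meijerG_eq_integral {a z : ℝ} (ha : 0 < a) (hz : 0 < z) :
    meijerG 1 2 ![(a : ℂ), 1] ![(a : ℂ), 0] (z : ℂ) =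
      ((∫ u in (0 : ℝ)..z, u ^ (a - 1) / (1 + u) : ℝ) : ℂ) := by
  have hex : ∃ σ : ℝ, MeijerSeparates 1 2 ![(a : ℂ), 1] ![(a : ℂ), 0] σ := by
    -- The midpoint of the admissible interval `(max (a - 1) 0, a)`.
    refine ⟨(max (a - 1) 0 + a) / 2, meijerSeparates_iff.2 ?_⟩
    have h1 : max (a - 1) 0 < a := max_lt (by linarith) ha
    have h2 := le_max_left (a - 1) 0
    have h3 := le_max_right (a - 1) 0
    exact ⟨by linarith, by linarith, by linarith⟩
  rw [meijerG, dif_pos hex]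
  obtain ⟨h1, h2, h3⟩ := meijerSeparates_iff.1 hex.choose_spec
  set σ := hex.choose
  -- The reciprocal endpoint reconciles `z ^ s` in the `G`-function with `x ^ (-s)` in Mellin
  -- inversion, applied at `x = z⁻¹`. Any separating line will do, so the choice in the definition
  -- is harmless.
  set f : ℝ → ℂ := fun x => ∫ u in (0 : ℝ)..x⁻¹, ((u ^ (a - 1) / (1 + u) : ℝ) : ℂ) with hf
  have hM : ∀ y : ℝ, HasMellin f (σ + y * Complex.I)
      (Complex.Gamma (a - (σ + y * Complex.I)) *
        Complex.Gamma (1 - (a - (σ + y * Complex.I))) / (σ + y * Complex.I)) := fun y =>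
    hasMellin_integral_rpow_div_one_add (by simpa) (by simpa) (by simpa)
  have hconv : MellinConvergent f σ := by simpa using (hM 0).1
  have hvert : Complex.VerticalIntegrable (mellin f) σ :=
    (verticalIntegrable_Gamma_mul_Gamma_div h3 h2 h1).congr
      (Filter.Eventually.of_forall fun y => (hM y).2.symm)
  have hcont : ContinuousAt f z⁻¹ := by
    have hk := intervalIntegrable_rpow_div_one_add ha hz
    have hd := intervalIntegral.integral_hasDerivAt_right
      (f := fun u : ℝ => ((u ^ (a - 1) / (1 + u) : ℝ) : ℂ))
      ⟨hk.1.ofReal, hk.2.ofReal⟩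
      (Measurable.stronglyMeasurable (by fun_prop)).stronglyMeasurableAtFilter
      (Complex.continuous_ofReal.continuousAt.comp
        ((Real.continuousAt_rpow_const _ _ (Or.inl hz.ne')).div (by fun_prop) (by positivity)))
    have hc : ContinuousAt (fun y : ℝ => ∫ u in (0 : ℝ)..y, ((u ^ (a - 1) / (1 + u) : ℝ) : ℂ))
        (z⁻¹)⁻¹ := by
      rw [inv_inv]
      exact hd.continuousAt
    exact hc.comp (continuousAt_inv₀ (inv_ne_zero hz.ne'))
  have hinv := mellinInv_mellin_eq σ f (inv_pos.2 hz) hconv hvert hcont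
  have hfz : f z⁻¹ = ((∫ u in (0 : ℝ)..z, u ^ (a - 1) / (1 + u) : ℝ) : ℂ) := by
    rw [hf]
    simp only [inv_inv]
    exact intervalIntegral.integral_ofReal
  rw [← hfz, ← hinv, mellinInv, Complex.real_smul]
  congr 1
  · push_cast
    ring
  · congr 1
    ext y
    rw [meijerIntegrand_one_two_two_two _ _ (by simpa), (hM y).2, smul_eq_mul, mul_comm]
    congr 1
    rw [Complex.ofReal_inv, Complex.inv_cpow _ _
      (by rw [Complex.arg_ofReal_of_nonneg hz.le]; exact Real.pi_pos.ne), ← Complex.cpow_neg,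
      neg_neg]

/-! ### Complex Gaussian and exponential laws -/

/-- Integration of a radial function against `CN(0, v)`. -/
theorem integral_comp_norm_complexGaussian {v : NNReal} (hv : v ≠ 0) (F : ℝ → ℝ) :
    ∫ z, F ‖z‖ ∂complexGaussian v =
      2 / v * ∫ y in Set.Ioi (0 : ℝ), y * Real.exp (-(y ^ 2 / v)) * F y := by
  have hv' : (0 : ℝ) < v := by positivity
  have hv2 : v / 2 ≠ 0 := by positivity
  have he : (fun p : ℝ × ℝ => (p.1 : ℂ) + (p.2 : ℂ) * Complex.I) =
      Complex.measurableEquivRealProd.symm := by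
    ext p
    simp [Complex.measurableEquivRealProd_symm_apply, Complex.mk_eq_add_mul_I]
  -- The product of the two Gaussian densities is the radial function `exp (-‖z‖ ^ 2 / v) / (π v)`,
  -- ready for polar coordinates.
  have hdens : ∀ p : ℝ × ℝ, (gaussianPDF 0 (v / 2) p.1 * gaussianPDF 0 (v / 2) p.2).toReal •
      F ‖Complex.measurableEquivRealProd.symm p‖ =
        (fun z : ℂ => 1 / (Real.pi * v) * (Real.exp (-(‖z‖ ^ 2 / v)) * F ‖z‖))
          (Complex.measurableEquivRealProd.symm p) := by
    intro p
    have hn : ‖Complex.measurableEquivRealProd.symm p‖ ^ 2 = p.1 ^ 2 + p.2 ^ 2 := by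
      rw [Complex.sq_norm, Complex.normSq_apply, Complex.measurableEquivRealProd_symm_apply]
      ring
    have h1 : 2 * Real.pi * ((v / 2 : NNReal) : ℝ) = Real.pi * v := by
      push_cast
      ring
    have h2 : 2 * ((v / 2 : NNReal) : ℝ) = v := by
      push_cast
      ring
    rw [ENNReal.toReal_mul, toReal_gaussianPDF, toReal_gaussianPDF, gaussianPDFReal,
      gaussianPDFReal]
    simp only [h1, h2, hn, smul_eq_mul, sub_zero]
    have hs : (√(Real.pi * v))⁻¹ * (√(Real.pi * v))⁻¹ = 1 / (Real.pi * v) := by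
      rw [← mul_inv, Real.mul_self_sqrt (by positivity), one_div]
    have hx : Real.exp (-p.1 ^ 2 / v) * Real.exp (-p.2 ^ 2 / v) =
        Real.exp (-((p.1 ^ 2 + p.2 ^ 2) / v)) := by
      rw [← Real.exp_add]
      ring_nf
    rw [← hs, ← hx]
    ring
  have hm : Measurable
      (fun p : ℝ × ℝ => gaussianPDF 0 (v / 2) p.1 * gaussianPDF 0 (v / 2) p.2) :=
    ((measurable_gaussianPDF _ _).comp measurable_fst).mul
      ((measurable_gaussianPDF _ _).comp measurable_snd)
  rw [complexGaussian, he, integral_map_equiv, gaussianReal_of_var_ne_zero _ hv2,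
    prod_withDensity (measurable_gaussianPDF _ _) (measurable_gaussianPDF _ _),
    integral_withDensity_eq_integral_toReal_smul hm (by simp [gaussianPDF, ENNReal.mul_lt_top])]
  rw [integral_congr_ae (Filter.Eventually.of_forall hdens), ← Measure.volume_eq_prod,
    Complex.volume_preserving_equiv_real_prod.symm.integral_comp'
      (fun z : ℂ => 1 / (Real.pi * v) * (Real.exp (-(‖z‖ ^ 2 / v)) * F ‖z‖)),
    integral_fun_norm_addHaar volume
      (fun y => 1 / (Real.pi * v) * (Real.exp (-(y ^ 2 / v)) * F y)), Complex.finrank_real_complex,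
    measureReal_def, Complex.volume_ball]
  simp only [smul_eq_mul, mul_left_comm _ (1 / (Real.pi * (v : ℝ)))]
  rw [integral_const_mul]
  simp
  field_simp

theorem integral_Ioi_mul_exp_neg_sq_div {v c : ℝ} (hv : 0 < v) :
    ∫ y in Set.Ioi c, y * Real.exp (-(y ^ 2 / v)) = v / 2 * Real.exp (-(c ^ 2 / v)) := by
  have hd : ∀ y ∈ Set.Ici c, HasDerivAt (fun y : ℝ => -(v / 2) * Real.exp (-(y ^ 2 / v)))
      (y * Real.exp (-(y ^ 2 / v))) y := by
    intro y _
    have h := ((((hasDerivAt_pow 2 y).div_const v).neg).exp).const_mul (-(v / 2))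
    refine h.congr_deriv ?_
    simp
    field_simp
  have hint : IntegrableOn (fun y : ℝ => y * Real.exp (-(y ^ 2 / v))) (Set.Ioi c) := by
    have := (integrable_mul_exp_neg_mul_sq (b := 1 / v) (by positivity)).integrableOn
      (s := Set.Ioi c)
    refine this.congr_fun (fun y _ => ?_) measurableSet_Ioi
    simp only
    ring_nf
  have hlim : Filter.Tendsto (fun y : ℝ => -(v / 2) * Real.exp (-(y ^ 2 / v))) Filter.atTop
      (nhds 0) := by
    rw [show (0 : ℝ) = -(v / 2) * 0 by ring]
    refine Filter.Tendsto.const_mul _ (Real.tendsto_exp_neg_atTop_nhds_zero.comp ?_)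
    exact (Filter.tendsto_pow_atTop (by norm_num)).atTop_div_const hv
  rw [integral_Ioi_of_hasDerivAt_of_tendsto' hd hint hlim]
  ring

instance (v : NNReal) : IsProbabilityMeasure (complexGaussian v) :=
  Measure.isProbabilityMeasure_map (by fun_prop)

/-- The squared modulus of a `CN(0, v)` variable is exponential with mean `v`. -/
theorem complexGaussian_map_norm_sq {v : NNReal} (hv : v ≠ 0) :
    (complexGaussian v).map (fun z => ‖z‖ ^ 2) = expMeasure (1 / v) := by
  have hv' : (0 : ℝ) < v := by positivity
  have := isProbabilityMeasure_expMeasure (r := 1 / (v : ℝ)) (by positivity)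
  have hm : Measurable (fun z : ℂ => ‖z‖ ^ 2) := by fun_prop
  have : IsProbabilityMeasure ((complexGaussian v).map (fun z => ‖z‖ ^ 2)) :=
    Measure.isProbabilityMeasure_map hm.aemeasurable
  apply Measure.eq_of_cdf
  ext x
  rw [cdf_expMeasure_eq (by positivity), cdf_eq_real, map_measureReal_apply hm measurableSet_Iic]
  split_ifs with hx
  · have hc : (fun z : ℂ => ‖z‖ ^ 2) ⁻¹' Set.Iic x = {z : ℂ | √x < ‖z‖}ᶜ := by
      ext z
      simp [Real.le_sqrt (norm_nonneg z) hx]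
    have hms : MeasurableSet {z : ℂ | √x < ‖z‖} := measurableSet_lt (by fun_prop) (by fun_prop)
    rw [hc, probReal_compl_eq_one_sub hms, ← integral_indicator_one hms]
    congr 1
    have := integral_comp_norm_complexGaussian hv ((Set.Ioi √x).indicator 1)
    refine this.trans ?_
    have h2 : ∀ y : ℝ, y * Real.exp (-(y ^ 2 / v)) * (Set.Ioi √x).indicator (1 : ℝ → ℝ) y =
        (Set.Ioi √x).indicator (fun y => y * Real.exp (-(y ^ 2 / v))) y := by
      intro y
      by_cases hy : y ∈ Set.Ioi √x <;> simp [hy]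
    simp_rw [h2]
    rw [setIntegral_indicator measurableSet_Ioi, Set.Ioi_inter_Ioi, sup_eq_right.2
      (Real.sqrt_nonneg x), integral_Ioi_mul_exp_neg_sq_div hv', Real.sq_sqrt hx]
    field_simp
  · have : (fun z : ℂ => ‖z‖ ^ 2) ⁻¹' Set.Iic x = ∅ := by
      ext z
      simp only [Set.mem_preimage, Set.mem_Iic, Set.mem_empty_iff_false, iff_false, not_le]
      exact lt_of_lt_of_le (not_le.1 hx) (sq_nonneg _)
    simp [this]

theorem expMeasure_map_const_mul {r c : ℝ} (hr : 0 < r) (hc : 0 < c) :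
    (expMeasure r).map (fun x => c * x) = expMeasure (r / c) := by
  have := isProbabilityMeasure_expMeasure hr
  have := isProbabilityMeasure_expMeasure (div_pos hr hc)
  have hm : Measurable (fun x : ℝ => c * x) := by fun_prop
  have : IsProbabilityMeasure ((expMeasure r).map (fun x => c * x)) :=
    Measure.isProbabilityMeasure_map hm.aemeasurable
  apply Measure.eq_of_cdf
  ext x
  have hpre : (fun x : ℝ => c * x) ⁻¹' Set.Iic x = Set.Iic (x / c) := by
    ext y
    simp [le_div_iff₀' hc]
  rw [cdf_eq_real, map_measureReal_apply hm measurableSet_Iic, hpre, ← cdf_eq_real,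
    cdf_expMeasure_eq hr, cdf_expMeasure_eq (div_pos hr hc)]
  have : 0 ≤ x / c ↔ 0 ≤ x := by rw [le_div_iff₀ hc, zero_mul]
  simp only [this]
  congr 4
  ring

/-- The scaled squared modulus of a `CN(0, v)` variable is exponential. -/
theorem complexGaussian_map_const_mul_norm_sq {v : NNReal} (hv : v ≠ 0) {c : ℝ} (hc : 0 < c) :
    (complexGaussian v).map (fun z => c * ‖z‖ ^ 2) = expMeasure (1 / (v * c)) := by
  have hv' : (0 : ℝ) < v := by positivity
  have := Measure.map_map (μ := complexGaussian v) (f := fun z : ℂ => ‖z‖ ^ 2)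
    (g := fun x : ℝ => c * x) (by fun_prop) (by fun_prop)
  rw [complexGaussian_map_norm_sq hv, expMeasure_map_const_mul (by positivity) hc, div_div] at this
  exact this.symm

/-! ### The uniform law on the ring -/

theorem measurableSet_eveRing (R₁ R₂ : ℝ) : MeasurableSet (eveRing R₁ R₂) :=
  (measurableSet_le measurable_const measurable_norm).inter
    (measurableSet_le measurable_norm measurable_const)

/-- Integration of a radial function over the ring. -/
theorem setIntegral_eveRing {R₁ R₂ : ℝ} (h1 : 0 < R₁) (h2 : R₁ < R₂) (g : ℝ → ℝ) :
    ∫ x in eveRing R₁ R₂, g ‖x‖ = 2 * (Real.pi * ∫ r in R₁..R₂, r * g r) := by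
  have hind : ∀ x : EuclideanSpace ℝ (Fin 2), (eveRing R₁ R₂).indicator (fun x => g ‖x‖) x =
      (Set.Icc R₁ R₂).indicator g ‖x‖ := fun x => rfl
  rw [← integral_indicator (measurableSet_eveRing R₁ R₂)]
  simp_rw [hind]
  rw [integral_fun_norm_addHaar volume ((Set.Icc R₁ R₂).indicator g), finrank_euclideanSpace_fin,
    measureReal_def, EuclideanSpace.volume_ball_fin_two, intervalIntegral.integral_of_le h2.le,
    ← integral_Icc_eq_integral_Ioc]
  have h3 : ∀ y : ℝ, y ^ (2 - 1) • (Set.Icc R₁ R₂).indicator g y =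
      (Set.Icc R₁ R₂).indicator (fun r => r * g r) y := by
    intro y
    by_cases hy : y ∈ Set.Icc R₁ R₂ <;> simp [hy]
  have hsub : Set.Ioi (0 : ℝ) ∩ Set.Icc R₁ R₂ = Set.Icc R₁ R₂ :=
    Set.inter_eq_right.2 fun y hy => lt_of_lt_of_le h1 hy.1
  simp_rw [h3]
  rw [setIntegral_indicator measurableSet_Icc, hsub]
  simp [Real.pi_pos.le]

theorem measureReal_eveRing {R₁ R₂ : ℝ} (h1 : 0 < R₁) (h2 : R₁ < R₂) :
    (volume (eveRing R₁ R₂)).toReal = Real.pi * (R₂ ^ 2 - R₁ ^ 2) := by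
  have := setIntegral_eveRing h1 h2 1
  simp only [Pi.one_apply, integral_const, mul_one, integral_id, smul_eq_mul, measureReal_def,
    Measure.restrict_apply_univ] at this
  rw [this]
  ring

/-- Expectation of a function of the distance of a uniform point of the ring. -/
theorem integral_norm_cond_eveRing {R₁ R₂ : ℝ} (h1 : 0 < R₁) (h2 : R₁ < R₂) (g : ℝ → ℝ) :
    ∫ x, g ‖x‖ ∂(cond volume (eveRing R₁ R₂)) =
      2 / (R₂ ^ 2 - R₁ ^ 2) * ∫ r in R₁..R₂, r * g r := by
  have : 0 < R₂ ^ 2 - R₁ ^ 2 := by nlinarith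
  rw [ProbabilityTheory.cond, integral_smul_measure, setIntegral_eveRing h1 h2, ENNReal.toReal_inv,
    measureReal_eveRing h1 h2, smul_eq_mul]
  have := Real.pi_pos
  field_simp

theorem isProbabilityMeasure_cond_eveRing {R₁ R₂ : ℝ} (h1 : 0 < R₁) (h2 : R₁ < R₂) :
    IsProbabilityMeasure (cond volume (eveRing R₁ R₂)) := by
  have hpos : 0 < (volume (eveRing R₁ R₂)).toReal := by
    rw [measureReal_eveRing h1 h2]
    have := Real.pi_pos
    have : 0 < R₂ ^ 2 - R₁ ^ 2 := by nlinarith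
    positivity
  exact cond_isProbabilityMeasure_of_finite (fun h => by simp [h] at hpos)
    (fun h => by simp [h] at hpos)

theorem ae_mem_cond_eveRing (R₁ R₂ : ℝ) :
    ∀ᵐ x ∂(cond volume (eveRing R₁ R₂)), x ∈ eveRing R₁ R₂ :=
  ae_cond_mem (measurableSet_eveRing R₁ R₂)

/-- Probabilities are computed as lower integrals, where Tonelli needs no integrability; this brings
the final average back to a real integral. Continuity on the compact interval supplies the bound
that makes `g` integrable. -/
theorem lintegral_ofReal_norm_cond_eveRing {R₁ R₂ : ℝ} (h1 : 0 < R₁) (h2 : R₁ < R₂) {g : ℝ → ℝ}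
    (hm : Measurable g) (hc : ContinuousOn g (Set.Icc R₁ R₂)) (h0 : ∀ r ∈ Set.Icc R₁ R₂, 0 ≤ g r) :
    ∫⁻ x, ENNReal.ofReal (g ‖x‖) ∂(ProbabilityTheory.cond volume (eveRing R₁ R₂)) =
      ENNReal.ofReal (2 / (R₂ ^ 2 - R₁ ^ 2) * ∫ r in R₁..R₂, r * g r) := by
  have := isProbabilityMeasure_cond_eveRing h1 h2
  obtain ⟨C, hC⟩ := isCompact_Icc.exists_bound_of_continuousOn hc
  have hint : Integrable (fun x => g ‖x‖) (ProbabilityTheory.cond volume (eveRing R₁ R₂)) := by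
    refine Integrable.of_bound (Measurable.aestronglyMeasurable (by fun_prop)) C ?_
    filter_upwards [ae_mem_cond_eveRing R₁ R₂] with x hx
    exact hC _ hx
  rw [← integral_norm_cond_eveRing h1 h2, ofReal_integral_eq_lintegral_ofReal hint]
  filter_upwards [ae_mem_cond_eveRing R₁ R₂] with x hx
  exact h0 _ hx

/-! ### Integrals against the exponential law -/

theorem lintegral_expMeasure (r : ℝ) {g : ℝ → ENNReal} (hg : Measurable g) :
    ∫⁻ y, g y ∂expMeasure r = ∫⁻ y, exponentialPDF r y * g y :=
  lintegral_withDensity_eq_lintegral_mul _ (measurable_exponentialPDFReal r).ennreal_ofReal hg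

theorem expMeasure_Iic {r y : ℝ} (hr : 0 < r) (hy : 0 ≤ y) :
    expMeasure r (Set.Iic y) = ENNReal.ofReal (1 - Real.exp (-(r * y))) := by
  have := isProbabilityMeasure_expMeasure hr
  rw [← ofReal_cdf, cdf_expMeasure_eq hr, if_pos hy]

theorem expMeasure_Ioi {r y : ℝ} (hr : 0 < r) (hy : 0 ≤ y) :
    expMeasure r (Set.Ioi y) = ENNReal.ofReal (Real.exp (-(r * y))) := by
  have := isProbabilityMeasure_expMeasure hr
  rw [← Set.compl_Iic, prob_compl_eq_one_sub measurableSet_Iic, expMeasure_Iic hr hy,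
    ← ENNReal.ofReal_one, ← ENNReal.ofReal_sub]
  · ring_nf
  · have : Real.exp (-(r * y)) ≤ 1 := Real.exp_le_one_iff.2 (by nlinarith)
    linarith

/-- The Laplace transform of the exponential law. -/
theorem lintegral_exp_neg_mul_expMeasure {r s : ℝ} (hr : 0 < r) (hs : 0 ≤ s) :
    ∫⁻ y, ENNReal.ofReal (Real.exp (-(s * y))) ∂expMeasure r = ENNReal.ofReal (r / (r + s)) := by
  have hrs : 0 < r + s := by linarith
  rw [lintegral_expMeasure r (by fun_prop)]
  -- Exponential tilting: the weighted density is a multiple of the density of rate `r + s`, which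
  -- has mass one.
  have h : ∀ y : ℝ, exponentialPDF r y * ENNReal.ofReal (Real.exp (-(s * y))) =
      ENNReal.ofReal (r / (r + s)) * exponentialPDF (r + s) y := by
    intro y
    simp only [exponentialPDF_eq]
    rw [← ENNReal.ofReal_mul (by split_ifs <;> positivity), ← ENNReal.ofReal_mul (by positivity)]
    congr 1
    split_ifs
    · rw [mul_assoc, ← Real.exp_add, ← mul_assoc, div_mul_cancel₀ _ hrs.ne']
      ring_nf
    · simp
  simp_rw [h]
  rw [lintegral_const_mul' _ _ ENNReal.ofReal_ne_top, lintegral_exponentialPDF_eq_one hrs, mul_one]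

/-! ### Radial integrals by substitution -/

/-- With `u = c * r ^ δ` one has `r dr = δ⁻¹ c ^ (-2/δ) u ^ (2/δ - 1) du`; as `R₁ > 0`, the power is
smooth on the whole range even for `δ < 1`. -/
theorem integral_mul_comp_const_mul_rpow {R₁ R₂ δ c : ℝ} (h1 : 0 < R₁) (h2 : R₁ < R₂) (hδ : 0 < δ)
    (hc : 0 < c) {h : ℝ → ℝ} (hh : ContinuousOn h (Set.Ioi 0)) :
    ∫ r in R₁..R₂, r * h (c * r ^ δ) =
      1 / δ * (1 / c) ^ (2 / δ) *
        ∫ u in (c * R₁ ^ δ)..(c * R₂ ^ δ), u ^ (2 / δ - 1) * h u := by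
  have hpos : ∀ r ∈ Set.uIcc R₁ R₂, 0 < r := by
    intro r hr
    rw [Set.uIcc_of_le h2.le] at hr
    exact lt_of_lt_of_le h1 hr.1
  have hsub := intervalIntegral.integral_comp_mul_deriv' (a := R₁) (b := R₂)
    (f := fun r => c * r ^ δ) (f' := fun r => c * (δ * r ^ (δ - 1)))
    (g := fun u => u ^ (2 / δ - 1) * h u)
    (fun r hr => (Real.hasDerivAt_rpow_const (Or.inl (hpos r hr).ne')).const_mul c)
    (by
      refine ContinuousOn.mul continuousOn_const (ContinuousOn.mul continuousOn_const ?_)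
      exact continuousOn_id.rpow_const fun r hr => Or.inl (hpos r hr).ne')
    (by
      have himg : (fun r => c * r ^ δ) '' Set.uIcc R₁ R₂ ⊆ Set.Ioi 0 := by
        rintro _ ⟨r, hr, rfl⟩
        exact mul_pos hc (Real.rpow_pos_of_pos (hpos r hr) _)
      refine ContinuousOn.mul ?_ (hh.mono himg)
      exact continuousOn_id.rpow_const fun u hu => Or.inl (ne_of_gt (himg hu)))
  rw [← hsub, ← intervalIntegral.integral_const_mul]
  refine intervalIntegral.integral_congr fun r hr => ?_
  have hr0 := hpos r hr
  simp only [Function.comp]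
  rw [Real.mul_rpow hc.le (Real.rpow_nonneg hr0.le _), ← Real.rpow_mul hr0.le, one_div c,
    Real.inv_rpow hc.le, Real.rpow_sub hc, Real.rpow_one,
    show δ * (2 / δ - 1) = 1 - (δ - 1) by field_simp; ring, Real.rpow_sub hr0, Real.rpow_one]
  have e1 := Real.rpow_pos_of_pos hr0 (δ - 1)
  have e2 := Real.rpow_pos_of_pos hc (2 / δ)
  field_simp

theorem lowerGamma_sub_lowerGamma {a x y : ℝ} (ha : 0 < a) :
    lowerGamma a y - lowerGamma a x = ∫ t in x..y, t ^ (a - 1) * Real.exp (-t) := by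
  have h : ∀ z : ℝ, IntervalIntegrable (fun t : ℝ => t ^ (a - 1) * Real.exp (-t)) volume 0 z :=
    fun z => (intervalIntegral.intervalIntegrable_rpow' (by linarith)).mul_continuousOn
      (by fun_prop)
  exact intervalIntegral.integral_interval_sub_left (h y) (h x)

theorem meijerG_sub_meijerG {a x y : ℝ} (ha : 0 < a) (hx : 0 < x) (hy : 0 < y) :
    meijerG 1 2 ![(a : ℂ), 1] ![(a : ℂ), 0] (y : ℂ) -
      meijerG 1 2 ![(a : ℂ), 1] ![(a : ℂ), 0] (x : ℂ) =
        ((∫ u in x..y, u ^ (a - 1) / (1 + u) : ℝ) : ℂ) := by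
  rw [meijerG_eq_integral ha hx, meijerG_eq_integral ha hy, ← Complex.ofReal_sub,
    intervalIntegral.integral_interval_sub_left (intervalIntegrable_rpow_div_one_add ha hy)
      (intervalIntegrable_rpow_div_one_add ha hx)]

/-! ### The laws of the two SNRs -/

theorem IsDiscretePhaseModel.map_bobSNR {L : ℕ} (hL : 1 ≤ L) {R₁ R₂ gB : ℝ} (hgB : 0 < gB)
    {Ω : Type*} [MeasurableSpace Ω] {P : Measure Ω} {εB εE : Ω → ℂ}
    {X : Ω → EuclideanSpace ℝ (Fin 2)} (h : IsDiscretePhaseModel L R₁ R₂ P εB εE X) :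
    P.map (bobSNR gB εB) = expMeasure (1 / (L * gB)) := by
  have hL0 : (L : NNReal) ≠ 0 := by positivity
  have h1 := complexGaussian_map_const_mul_norm_sq hL0 hgB
  rw [← h.law_bob, Measure.map_map (by fun_prop) h.measurable_bob, NNReal.coe_natCast] at h1
  exact h1

theorem measurable_const_mul_norm_sq_div_norm_rpow (gE δ : ℝ) :
    Measurable (fun z : ℂ × EuclideanSpace ℝ (Fin 2) => gE * ‖z.1‖ ^ 2 / ‖z.2‖ ^ δ) := by
  fun_prop

theorem IsDiscretePhaseModel.measurable_eveSNR {L : ℕ} {R₁ R₂ : ℝ} (gE δ : ℝ)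
    {Ω : Type*} [MeasurableSpace Ω] {P : Measure Ω} {εB εE : Ω → ℂ}
    {X : Ω → EuclideanSpace ℝ (Fin 2)} (h : IsDiscretePhaseModel L R₁ R₂ P εB εE X) :
    Measurable (eveSNR gE δ εE X) :=
  (measurable_const_mul_norm_sq_div_norm_rpow gE δ).comp (h.measurable_eve.prodMk h.measurable_pos)

theorem IsDiscretePhaseModel.measurable_bobSNR {L : ℕ} {R₁ R₂ : ℝ} (gB : ℝ)
    {Ω : Type*} [MeasurableSpace Ω] {P : Measure Ω} {εB εE : Ω → ℂ}
    {X : Ω → EuclideanSpace ℝ (Fin 2)} (h : IsDiscretePhaseModel L R₁ R₂ P εB εE X) :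
    Measurable (bobSNR gB εB) :=
  (h.measurable_bob.norm.pow_const 2).const_mul gB

/-- Given Eve's position `x`, her SNR is exponential with rate `‖x‖ ^ δ / (L * gE)`. -/
theorem IsDiscretePhaseModel.lintegral_comp_eveSNR {L : ℕ} (hL : 1 ≤ L) {R₁ R₂ gE δ : ℝ}
    (h1 : 0 < R₁) (h2 : R₁ < R₂) (hgE : 0 < gE)
    {Ω : Type*} [MeasurableSpace Ω] {P : Measure Ω} [IsProbabilityMeasure P] {εB εE : Ω → ℂ}
    {X : Ω → EuclideanSpace ℝ (Fin 2)} (h : IsDiscretePhaseModel L R₁ R₂ P εB εE X)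
    {g : ℝ → ENNReal} (hg : Measurable g) :
    ∫⁻ ω, g (eveSNR gE δ εE X ω) ∂P =
      ∫⁻ x, (∫⁻ y, g y ∂expMeasure (‖x‖ ^ δ / (L * gE)))
        ∂(ProbabilityTheory.cond volume (eveRing R₁ R₂)) := by
  have := isProbabilityMeasure_cond_eveRing h1 h2
  have hL0 : (L : NNReal) ≠ 0 := by positivity
  have hjoint := (indepFun_iff_map_prod_eq_prod_map_map h.measurable_eve.aemeasurable
    h.measurable_pos.aemeasurable).1 h.indep_eve_pos
  have hpos : P.map X = ProbabilityTheory.cond volume (eveRing R₁ R₂) := h.law_pos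
  rw [h.law_eve, hpos] at hjoint
  have hgm := hg.comp (measurable_const_mul_norm_sq_div_norm_rpow gE δ)
  have hmap := lintegral_map (μ := P) hgm (h.measurable_eve.prodMk h.measurable_pos)
  refine hmap.symm.trans ?_
  -- By independence the position can be frozen in the outer integral; the SNR is then `gE / ‖x‖ ^
  -- δ` times a squared Gaussian modulus.
  rw [hjoint, lintegral_prod_symm' _ hgm]
  refine lintegral_congr_ae ?_
  filter_upwards [ae_mem_cond_eveRing R₁ R₂] with x hx
  have hx0 : 0 < ‖x‖ := lt_of_lt_of_le h1 hx.1
  have hxδ : 0 < ‖x‖ ^ δ := Real.rpow_pos_of_pos hx0 _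
  have hlaw := complexGaussian_map_const_mul_norm_sq hL0 (div_pos hgE hxδ)
  have hrate : 1 / (((L : NNReal) : ℝ) * (gE / ‖x‖ ^ δ)) = ‖x‖ ^ δ / (L * gE) := by
    rw [NNReal.coe_natCast]
    field_simp
  rw [← hrate, ← hlaw, lintegral_map hg (by fun_prop)]
  refine lintegral_congr fun z => ?_
  simp only [Function.comp]
  congr 1
  ring

theorem measurable_uncurry_exponentialPDF :
    Measurable (fun z : ℝ × ℝ => exponentialPDF z.1 z.2) := by
  simp only [exponentialPDF_eq]
  exact (Measurable.ite (measurableSet_le measurable_const measurable_snd) (by fun_prop)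
    measurable_const).ennreal_ofReal

/-- The mixture of the exponential densities over the position of Eve. -/
theorem lintegral_exponentialPDF_cond_eveRing {R₁ R₂ δ b y : ℝ} (h1 : 0 < R₁) (h2 : R₁ < R₂)
    (hδ : 0 < δ) (hb : 0 < b) (hy : 0 < y) :
    ∫⁻ x, exponentialPDF (‖x‖ ^ δ / b) y ∂(ProbabilityTheory.cond volume (eveRing R₁ R₂)) =
      ENNReal.ofReal (2 / (δ * b * (R₂ ^ 2 - R₁ ^ 2)) * (b / y) ^ (1 + 2 / δ) *
        (lowerGamma (1 + 2 / δ) (R₂ ^ δ / b * y) - lowerGamma (1 + 2 / δ) (R₁ ^ δ / b * y))) := by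
  have hΔ : 0 < R₂ ^ 2 - R₁ ^ 2 := by nlinarith
  simp only [exponentialPDF_of_nonneg hy.le]
  have hcont : ContinuousOn (fun r : ℝ => r ^ δ / b * Real.exp (-(r ^ δ / b * y)))
      (Set.Icc R₁ R₂) := by
    have : ContinuousOn (fun r : ℝ => r ^ δ) (Set.Icc R₁ R₂) :=
      continuousOn_id.rpow_const fun r hr => Or.inr hδ.le
    fun_prop
  rw [lintegral_ofReal_norm_cond_eveRing h1 h2
    (g := fun r => r ^ δ / b * Real.exp (-(r ^ δ / b * y))) (by fun_prop) hcont
    (fun r hr => by have := lt_of_lt_of_le h1 hr.1; positivity)]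
  congr 1
  -- For `u = (y / b) * r ^ δ` the rate `r ^ δ / b` is `u / y`, so the density is `u * exp (-u) /
  -- y`; the factor `u` raises the Gamma parameter to `1 + 2 / δ`.
  have hsub := integral_mul_comp_const_mul_rpow h1 h2 hδ (div_pos hy hb)
    (h := fun u => 1 / y * (u * Real.exp (-u))) (by fun_prop)
  have e1 : ∀ r : ℝ, r * (r ^ δ / b * Real.exp (-(r ^ δ / b * y))) =
      r * (1 / y * (y / b * r ^ δ * Real.exp (-(y / b * r ^ δ)))) := by
    intro r
    have : r ^ δ / b * y = y / b * r ^ δ := by ring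
    rw [this]
    field_simp
  simp_rw [e1]
  rw [hsub, lowerGamma_sub_lowerGamma (by positivity)]
  have e2 : ∀ R : ℝ, R ^ δ / b * y = y / b * R ^ δ := fun R => by ring
  rw [e2, e2]
  have e3 : ∫ u in (y / b * R₁ ^ δ)..(y / b * R₂ ^ δ),
      u ^ (2 / δ - 1) * (1 / y * (u * Real.exp (-u))) =
        1 / y * ∫ u in (y / b * R₁ ^ δ)..(y / b * R₂ ^ δ),
          u ^ (1 + 2 / δ - 1) * Real.exp (-u) := by
    rw [← intervalIntegral.integral_const_mul]
    refine intervalIntegral.integral_congr fun u hu => ?_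
    have hu0 : 0 < u := by
      have hle : y / b * R₁ ^ δ ≤ y / b * R₂ ^ δ := by gcongr
      rw [Set.uIcc_of_le hle] at hu
      exact lt_of_lt_of_le (by positivity) hu.1
    rw [show (1 : ℝ) + 2 / δ - 1 = (2 / δ - 1) + 1 by ring, Real.rpow_add_one hu0.ne']
    ring
  rw [e3, one_div_div, Real.rpow_add (by positivity), Real.rpow_one]
  field_simp

/-- By Tonelli, a mixture of exponential laws has the mixture of their densities as density. -/
theorem IsDiscretePhaseModel.map_eveSNR {L : ℕ} (hL : 1 ≤ L) {R₁ R₂ gE δ : ℝ}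
    (h1 : 0 < R₁) (h2 : R₁ < R₂) (hδ : 0 < δ) (hgE : 0 < gE)
    {Ω : Type*} [MeasurableSpace Ω] {P : Measure Ω} [IsProbabilityMeasure P] {εB εE : Ω → ℂ}
    {X : Ω → EuclideanSpace ℝ (Fin 2)} (h : IsDiscretePhaseModel L R₁ R₂ P εB εE X) :
    P.map (eveSNR gE δ εE X) = volume.withDensity (fun x : ℝ => ENNReal.ofReal
      (if 0 < x then
        2 / (δ * L * gE * (R₂ ^ 2 - R₁ ^ 2)) * (L * gE / x) ^ (1 + 2 / δ) *
          (lowerGamma (1 + 2 / δ) (R₂ ^ δ / (L * gE) * x) -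
            lowerGamma (1 + 2 / δ) (R₁ ^ δ / (L * gE) * x))
      else 0)) := by
  have := isProbabilityMeasure_cond_eveRing h1 h2
  have hL0 : (0 : ℝ) < L := by exact_mod_cast hL
  have hb : 0 < L * gE := by positivity
  have hm : Measurable (fun z : EuclideanSpace ℝ (Fin 2) × ℝ =>
      exponentialPDF (‖z.1‖ ^ δ / (L * gE)) z.2) :=
    measurable_uncurry_exponentialPDF.comp
      (f := fun z : EuclideanSpace ℝ (Fin 2) × ℝ => (‖z.1‖ ^ δ / (L * gE), z.2)) (by fun_prop)
  have hdens : (fun x : ℝ => ENNReal.ofReal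
      (if 0 < x then
        2 / (δ * L * gE * (R₂ ^ 2 - R₁ ^ 2)) * (L * gE / x) ^ (1 + 2 / δ) *
          (lowerGamma (1 + 2 / δ) (R₂ ^ δ / (L * gE) * x) -
            lowerGamma (1 + 2 / δ) (R₁ ^ δ / (L * gE) * x))
      else 0)) =ᵐ[volume] fun y => ∫⁻ x, exponentialPDF (‖x‖ ^ δ / (L * gE)) y
        ∂(ProbabilityTheory.cond volume (eveRing R₁ R₂)) := by
    -- At `0` the exponential densities are positive while the stated density is `0`; this null set
    -- is discarded.
    filter_upwards [Measure.ae_ne volume (0 : ℝ)] with y hy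
    split_ifs with hy0
    · rw [lintegral_exponentialPDF_cond_eveRing h1 h2 hδ hb hy0]
      ring_nf
    · have hy' : y < 0 := lt_of_le_of_ne (not_lt.1 hy0) hy
      simp [exponentialPDF_of_neg hy']
  rw [withDensity_congr_ae hdens]
  refine Measure.ext_of_lintegral _ fun g hg => ?_
  have hmix : Measurable (fun y : ℝ => ∫⁻ x, exponentialPDF (‖x‖ ^ δ / (L * gE)) y
      ∂(ProbabilityTheory.cond volume (eveRing R₁ R₂))) := hm.lintegral_prod_left'
  have hmg : Measurable (fun z : EuclideanSpace ℝ (Fin 2) × ℝ =>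
      exponentialPDF (‖z.1‖ ^ δ / (L * gE)) z.2 * g z.2) := hm.mul (hg.comp measurable_snd)
  have hsec : ∀ y : ℝ, Measurable (fun x : EuclideanSpace ℝ (Fin 2) =>
      exponentialPDF (‖x‖ ^ δ / (L * gE)) y) := fun y => hm.of_uncurry_right
  rw [lintegral_map hg (h.measurable_eveSNR gE δ), h.lintegral_comp_eveSNR hL h1 h2 hgE hg,
    lintegral_withDensity_eq_lintegral_mul _ hmix hg]
  simp_rw [lintegral_expMeasure _ hg]
  rw [lintegral_lintegral_swap hmg.aemeasurable]
  refine lintegral_congr fun y => ?_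
  rw [Pi.mul_apply, lintegral_mul_const _ (hsec y)]

/-- The exponential distribution functions are averaged directly, without integrating the density.
No factor `u` appears, hence the parameter `2 / δ`. -/
theorem IsDiscretePhaseModel.cdf_eveSNR {L : ℕ} (hL : 1 ≤ L) {R₁ R₂ gE δ : ℝ}
    (h1 : 0 < R₁) (h2 : R₁ < R₂) (hδ : 0 < δ) (hgE : 0 < gE)
    {Ω : Type*} [MeasurableSpace Ω] {P : Measure Ω} [IsProbabilityMeasure P] {εB εE : Ω → ℂ}
    {X : Ω → EuclideanSpace ℝ (Fin 2)} (h : IsDiscretePhaseModel L R₁ R₂ P εB εE X)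
    {x : ℝ} (hx : 0 < x) :
    P.real {ω | eveSNR gE δ εE X ω ≤ x} =
      1 - 2 / (δ * (R₂ ^ 2 - R₁ ^ 2)) * (L * gE / x) ^ (2 / δ) *
        (lowerGamma (2 / δ) (R₂ ^ δ * x / (L * gE)) -
          lowerGamma (2 / δ) (R₁ ^ δ * x / (L * gE))) := by
  have hL0 : (0 : ℝ) < L := by exact_mod_cast hL
  have hb : 0 < L * gE := by positivity
  have hΔ : 0 < R₂ ^ 2 - R₁ ^ 2 := by nlinarith
  have hms : MeasurableSet {ω | eveSNR gE δ εE X ω ≤ x} :=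
    measurableSet_le (h.measurable_eveSNR gE δ) measurable_const
  have hcont : ContinuousOn (fun r : ℝ => r ^ δ) (Set.Icc R₁ R₂) :=
    continuousOn_id.rpow_const fun r hr => Or.inr hδ.le
  have hP : P {ω | eveSNR gE δ εE X ω ≤ x} = ENNReal.ofReal (2 / (R₂ ^ 2 - R₁ ^ 2) *
      ∫ r in R₁..R₂, r * (1 - Real.exp (-(r ^ δ / (L * gE) * x)))) := by
    rw [← lintegral_indicator_one hms]
    have := h.lintegral_comp_eveSNR (δ := δ) hL h1 h2 hgE
      (g := (Set.Iic x).indicator 1) (measurable_one.indicator measurableSet_Iic)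
    refine this.trans ?_
    rw [← lintegral_ofReal_norm_cond_eveRing h1 h2
      (g := fun r => 1 - Real.exp (-(r ^ δ / (L * gE) * x))) (by fun_prop) (by fun_prop)
      (fun r hr => sub_nonneg.2 (Real.exp_le_one_iff.2 (by
        have := lt_of_lt_of_le h1 hr.1
        exact neg_nonpos.2 (by positivity))))]
    refine lintegral_congr_ae ?_
    filter_upwards [ae_mem_cond_eveRing R₁ R₂] with z hz
    have hz0 : 0 < ‖z‖ := lt_of_lt_of_le h1 hz.1
    rw [lintegral_indicator_one measurableSet_Iic, expMeasure_Iic (by positivity) hx.le]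
  have hsub := integral_mul_comp_const_mul_rpow h1 h2 hδ (div_pos hx hb)
    (h := fun u => Real.exp (-u)) (by fun_prop)
  have e2 : ∀ R : ℝ, R ^ δ * x / (L * gE) = x / (L * gE) * R ^ δ := fun R => by ring
  have hint1 : IntervalIntegrable (fun r : ℝ => r) volume R₁ R₂ :=
    continuous_id.intervalIntegrable _ _
  have hint2 : IntervalIntegrable (fun r : ℝ => r * Real.exp (-(x / (L * gE) * r ^ δ)))
      volume R₁ R₂ := by
    refine ContinuousOn.intervalIntegrable ?_
    rw [Set.uIcc_of_le h2.le]
    fun_prop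
  have hval : 2 / (R₂ ^ 2 - R₁ ^ 2) *
      ∫ r in R₁..R₂, r * (1 - Real.exp (-(r ^ δ / (L * gE) * x))) =
        1 - 2 / (δ * (R₂ ^ 2 - R₁ ^ 2)) * (L * gE / x) ^ (2 / δ) *
        (lowerGamma (2 / δ) (R₂ ^ δ * x / (L * gE)) -
          lowerGamma (2 / δ) (R₁ ^ δ * x / (L * gE))) := by
    have e1 : ∀ r : ℝ, r * (1 - Real.exp (-(r ^ δ / (L * gE) * x))) =
        r - r * Real.exp (-(x / (L * gE) * r ^ δ)) := by
      intro r
      have : r ^ δ / (L * gE) * x = x / (L * gE) * r ^ δ := by ring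
      rw [this]
      ring
    simp_rw [e1]
    rw [intervalIntegral.integral_sub hint1 hint2, hsub, lowerGamma_sub_lowerGamma (by positivity),
      e2, e2, integral_id, one_div_div]
    field_simp
  rw [measureReal_def, hP, ENNReal.toReal_ofReal, hval]
  refine mul_nonneg (by positivity) (intervalIntegral.integral_nonneg h2.le fun r hr => ?_)
  have := lt_of_lt_of_le h1 hr.1
  refine mul_nonneg this.le (sub_nonneg.2 (Real.exp_le_one_iff.2 (neg_nonpos.2 ?_)))
  positivity

/-! ### Comparison of the two SNRs -/

theorem bobSNR_nonneg {Ω : Type*} {gB : ℝ} (hgB : 0 < gB) (εB : Ω → ℂ) (ω : Ω) :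
    0 ≤ bobSNR gB εB ω := by
  unfold bobSNR
  positivity

theorem eveSNR_nonneg {Ω : Type*} {gE : ℝ} (hgE : 0 < gE) (δ : ℝ) (εE : Ω → ℂ)
    (X : Ω → EuclideanSpace ℝ (Fin 2)) (ω : Ω) : 0 ≤ eveSNR gE δ εE X ω := by
  unfold eveSNR
  positivity

/-- The probability that Bob's SNR does not exceed an affine function of Eve's SNR. -/
theorem IsDiscretePhaseModel.measureReal_bobSNR_le {L : ℕ} (hL : 1 ≤ L) {R₁ R₂ gB gE δ a w : ℝ}
    (h1 : 0 < R₁) (h2 : R₁ < R₂) (hδ : 0 < δ) (hgB : 0 < gB) (hgE : 0 < gE)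
    (ha : 0 < a) (hw : 0 ≤ w)
    {Ω : Type*} [MeasurableSpace Ω] {P : Measure Ω} [IsProbabilityMeasure P] {εB εE : Ω → ℂ}
    {X : Ω → EuclideanSpace ℝ (Fin 2)} (h : IsDiscretePhaseModel L R₁ R₂ P εB εE X) :
    P.real {ω | bobSNR gB εB ω ≤ a * eveSNR gE δ εE X ω + w} =
      1 - Real.exp (-(w / (L * gB))) * (2 / (R₂ ^ 2 - R₁ ^ 2) *
        ∫ r in R₁..R₂, r * (gB / (a * gE) * r ^ δ / (1 + gB / (a * gE) * r ^ δ))) := by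
  have hL0 : (0 : ℝ) < L := by exact_mod_cast hL
  have hΔ : 0 < R₂ ^ 2 - R₁ ^ 2 := by nlinarith
  have hmB := h.measurable_bobSNR gB
  have hmE := h.measurable_eveSNR gE δ
  have hbE : 0 < L * gE := by positivity
  have hβ : 0 < 1 / (L * gB) := by positivity
  have := isProbabilityMeasure_expMeasure hβ
  have : IsProbabilityMeasure (P.map (eveSNR gE δ εE X)) :=
    Measure.isProbabilityMeasure_map hmE.aemeasurable
  have hind : IndepFun (bobSNR gB εB) (eveSNR gE δ εE X) P :=
    h.indep_bob.comp (φ := fun z : ℂ => gB * ‖z‖ ^ 2) (by fun_prop)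
      (measurable_const_mul_norm_sq_div_norm_rpow gE δ)
  have hjoint := (indepFun_iff_map_prod_eq_prod_map_map hmB.aemeasurable hmE.aemeasurable).1 hind
  rw [h.map_bobSNR hL hgB] at hjoint
  have hset : MeasurableSet {p : ℝ × ℝ | a * p.2 + w < p.1} :=
    measurableSet_lt (by fun_prop) (by fun_prop)
  have hP : P {ω | a * eveSNR gE δ εE X ω + w < bobSNR gB εB ω} =
      ENNReal.ofReal (Real.exp (-(w / (L * gB))) * (2 / (R₂ ^ 2 - R₁ ^ 2) *
        ∫ r in R₁..R₂, r * (gB / (a * gE) * r ^ δ / (1 + gB / (a * gE) * r ^ δ)))) := by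
    have hmap := Measure.map_apply (μ := P) (hmB.prodMk hmE) hset
    refine hmap.symm.trans ?_
    rw [hjoint, Measure.prod_apply_symm hset, lintegral_map (measurable_measure_prodMk_right hset)
      hmE]
    -- Bob's tail at `a γ_E + w` factors, leaving the Laplace transform of Eve's SNR at `a / (L
    -- gB)`.
    have hin : ∀ ω, expMeasure (1 / (L * gB))
        ((fun x => (x, eveSNR gE δ εE X ω)) ⁻¹' {p : ℝ × ℝ | a * p.2 + w < p.1}) =
          ENNReal.ofReal (Real.exp (-(w / (L * gB)))) *
            ENNReal.ofReal (Real.exp (-(a / (L * gB) * eveSNR gE δ εE X ω))) := by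
      intro ω
      have hE := eveSNR_nonneg hgE δ εE X ω
      have hpre : (fun x => (x, eveSNR gE δ εE X ω)) ⁻¹' {p : ℝ × ℝ | a * p.2 + w < p.1} =
          Set.Ioi (a * eveSNR gE δ εE X ω + w) := rfl
      rw [hpre, expMeasure_Ioi hβ (by positivity), ← ENNReal.ofReal_mul (Real.exp_pos _).le,
        ← Real.exp_add]
      ring_nf
    simp_rw [hin]
    rw [lintegral_const_mul' _ _ ENNReal.ofReal_ne_top, h.lintegral_comp_eveSNR hL h1 h2 hgE
      (g := fun y => ENNReal.ofReal (Real.exp (-(a / (L * gB) * y)))) (by fun_prop), ENNReal.ofReal_mul (Real.exp_pos _).le]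
    congr 1
    have hz : 0 < gB / (a * gE) := by positivity
    have hcont : ContinuousOn (fun r : ℝ => gB / (a * gE) * r ^ δ) (Set.Icc R₁ R₂) :=
      continuousOn_const.mul (continuousOn_id.rpow_const fun r hr => Or.inr hδ.le)
    rw [← lintegral_ofReal_norm_cond_eveRing h1 h2
      (g := fun r => gB / (a * gE) * r ^ δ / (1 + gB / (a * gE) * r ^ δ)) (by fun_prop)
      (hcont.div (continuousOn_const.add hcont) (fun r hr => by
        have := lt_of_lt_of_le h1 hr.1
        positivity))
      (fun r hr => by
        have := lt_of_lt_of_le h1 hr.1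
        positivity)]
    refine lintegral_congr_ae ?_
    filter_upwards [ae_mem_cond_eveRing R₁ R₂] with z hz'
    have hz0 : 0 < ‖z‖ := lt_of_lt_of_le h1 hz'.1
    have hzδ : 0 < ‖z‖ ^ δ := Real.rpow_pos_of_pos hz0 _
    -- In `r / (r + s)` with `r = ‖z‖ ^ δ / (L gE)` and `s = a / (L gB)`, the number `L` cancels.
    rw [lintegral_exp_neg_mul_expMeasure (by positivity) (by positivity)]
    congr 1
    field_simp
    ring
  have hcompl : {ω | bobSNR gB εB ω ≤ a * eveSNR gE δ εE X ω + w} =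
      {ω | a * eveSNR gE δ εE X ω + w < bobSNR gB εB ω}ᶜ := by
    ext ω
    simp
  rw [hcompl, probReal_compl_eq_one_sub (measurableSet_lt (by fun_prop) hmB), measureReal_def, hP,
    ENNReal.toReal_ofReal]
  refine mul_nonneg (Real.exp_pos _).le (mul_nonneg (by positivity)
    (intervalIntegral.integral_nonneg h2.le fun r hr => ?_))
  have := lt_of_lt_of_le h1 hr.1
  positivity

/-! ### Ring averages as `G`-functions -/

/-- Here `h(u) = u / (1 + u)`, whose numerator shifts the parameter from `2 / δ` to `1 + 2 / δ`. -/
theorem ofReal_two_div_mul_integral_div_one_add {R₁ R₂ δ z : ℝ} (h1 : 0 < R₁) (h2 : R₁ < R₂)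
    (hδ : 0 < δ) (hz : 0 < z) :
    ((2 / (R₂ ^ 2 - R₁ ^ 2) * ∫ r in R₁..R₂, r * (z * r ^ δ / (1 + z * r ^ δ)) : ℝ) : ℂ) =
      ((2 / (δ * (R₂ ^ 2 - R₁ ^ 2)) * (1 / z) ^ (2 / δ) : ℝ) : ℂ) *
        (meijerG 1 2 ![1 + 2 / (δ : ℂ), 1] ![1 + 2 / (δ : ℂ), 0] ((z * R₂ ^ δ : ℝ) : ℂ) -
          meijerG 1 2 ![1 + 2 / (δ : ℂ), 1] ![1 + 2 / (δ : ℂ), 0] ((z * R₁ ^ δ : ℝ) : ℂ)) := by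
  have hR₂ : 0 < R₂ := h1.trans h2
  have hsub := integral_mul_comp_const_mul_rpow h1 h2 hδ hz (h := fun u => u / (1 + u))
    (ContinuousOn.div (by fun_prop) (by fun_prop) fun u hu => by
      have : (0 : ℝ) < u := hu
      positivity)
  have ha : (1 + 2 / (δ : ℂ)) = ((1 + 2 / δ : ℝ) : ℂ) := by push_cast; rfl
  have e3 : ∫ u in (z * R₁ ^ δ)..(z * R₂ ^ δ), u ^ (2 / δ - 1) * (u / (1 + u)) =
      ∫ u in (z * R₁ ^ δ)..(z * R₂ ^ δ), u ^ (1 + 2 / δ - 1) / (1 + u) := by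
    refine intervalIntegral.integral_congr fun u hu => ?_
    have hu0 : 0 < u := by
      have hle : z * R₁ ^ δ ≤ z * R₂ ^ δ := by gcongr
      rw [Set.uIcc_of_le hle] at hu
      exact lt_of_lt_of_le (by positivity) hu.1
    rw [show (1 : ℝ) + 2 / δ - 1 = (2 / δ - 1) + 1 by ring, Real.rpow_add_one hu0.ne']
    ring
  rw [ha, meijerG_sub_meijerG (by positivity) (by positivity) (by positivity), hsub, e3,
    ← Complex.ofReal_mul]
  congr 1
  field_simp

/-- Writing `u / (1 + u) = 1 - 1 / (1 + u)` keeps the parameter at `2 / δ`; the constant averages to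
`1`. This is the form needed for the PNZ. -/
theorem ofReal_two_div_mul_integral_div_one_add_eq_one_sub {R₁ R₂ δ z : ℝ} (h1 : 0 < R₁)
    (h2 : R₁ < R₂) (hδ : 0 < δ) (hz : 0 < z) :
    ((2 / (R₂ ^ 2 - R₁ ^ 2) * ∫ r in R₁..R₂, r * (z * r ^ δ / (1 + z * r ^ δ)) : ℝ) : ℂ) =
      1 - ((2 / (δ * (R₂ ^ 2 - R₁ ^ 2)) * (1 / z) ^ (2 / δ) : ℝ) : ℂ) *
        (meijerG 1 2 ![2 / (δ : ℂ), 1] ![2 / (δ : ℂ), 0] ((z * R₂ ^ δ : ℝ) : ℂ) -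
          meijerG 1 2 ![2 / (δ : ℂ), 1] ![2 / (δ : ℂ), 0] ((z * R₁ ^ δ : ℝ) : ℂ)) := by
  have hR₂ : 0 < R₂ := h1.trans h2
  have hΔ : 0 < R₂ ^ 2 - R₁ ^ 2 := by nlinarith
  have hsub := integral_mul_comp_const_mul_rpow h1 h2 hδ hz (h := fun u => 1 / (1 + u))
    (ContinuousOn.div (by fun_prop) (by fun_prop) fun u hu => by
      have : (0 : ℝ) < u := hu
      positivity)
  have ha : (2 / (δ : ℂ)) = ((2 / δ : ℝ) : ℂ) := by push_cast; rfl
  have hcont : ContinuousOn (fun r : ℝ => z * r ^ δ) (Set.uIcc R₁ R₂) :=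
    continuousOn_const.mul (continuousOn_id.rpow_const fun r hr => Or.inr hδ.le)
  have hpos : ∀ r ∈ Set.uIcc R₁ R₂, 0 < 1 + z * r ^ δ := by
    intro r hr
    rw [Set.uIcc_of_le h2.le] at hr
    have := lt_of_lt_of_le h1 hr.1
    positivity
  have hint : IntervalIntegrable (fun r : ℝ => r * (1 / (1 + z * r ^ δ))) volume R₁ R₂ :=
    (continuousOn_id.mul (continuousOn_const.div (continuousOn_const.add hcont)
      fun r hr => (hpos r hr).ne')).intervalIntegrable
  have hid : IntervalIntegrable (fun r : ℝ => r) volume R₁ R₂ :=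
    continuous_id.intervalIntegrable _ _
  have e1 : ∫ r in R₁..R₂, r * (z * r ^ δ / (1 + z * r ^ δ)) =
      ∫ r in R₁..R₂, (r - r * (1 / (1 + z * r ^ δ))) := by
    refine intervalIntegral.integral_congr fun r hr => ?_
    have := hpos r hr
    field_simp
    ring
  rw [e1, intervalIntegral.integral_sub hid hint, hsub, ha,
    meijerG_sub_meijerG (by positivity) (by positivity) (by positivity),
    ← Complex.ofReal_mul, ← Complex.ofReal_one, ← Complex.ofReal_sub]
  congr 1
  simp only [mul_one_div, integral_id]
  field_simp

/-! ### Secrecy events and their probabilities -/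

theorem secrecyCapacity_le_iff {Ω : Type*} {γB γE : Ω → ℝ} {Rt : ℝ} (hRt : 0 ≤ Rt) {ω : Ω}
    (hB : 0 ≤ γB ω) (hE : 0 ≤ γE ω) :
    secrecyCapacity γB γE ω ≤ Rt ↔ γB ω ≤ (2 : ℝ) ^ Rt * γE ω + ((2 : ℝ) ^ Rt - 1) := by
  have hE' : 0 < 1 + γE ω := by linarith
  have hB' : 0 < 1 + γB ω := by linarith
  have h2 : (0 : ℝ) < 2 ^ Rt := by positivity
  rw [secrecyCapacity, max_le_iff, and_iff_left hRt, ← Real.logb_div hB'.ne' hE'.ne',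
    Real.logb_le_iff_le_rpow one_lt_two (by positivity), div_le_iff₀ hE']
  constructor <;> intro h <;> linarith

theorem secrecyCapacity_pos_iff {Ω : Type*} {γB γE : Ω → ℝ} {ω : Ω}
    (hB : 0 ≤ γB ω) (hE : 0 ≤ γE ω) : 0 < secrecyCapacity γB γE ω ↔ γE ω < γB ω := by
  have := secrecyCapacity_le_iff le_rfl hB hE
  rw [← not_le, this, not_le]
  simp

section model

variable {L : ℕ} {R₁ R₂ gB gE δ Rt : ℝ} {Ω : Type*} [MeasurableSpace Ω] {P : Measure Ω}
  [IsProbabilityMeasure P] {εB εE : Ω → ℂ} {X : Ω → EuclideanSpace ℝ (Fin 2)}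

/-- The comparison formula with `a = R_s`, `w = W`, before the exponential is expanded. -/
theorem IsDiscretePhaseModel.secrecyOutageProb_eq (hL : 1 ≤ L) (h1 : 0 < R₁) (h2 : R₁ < R₂)
    (hδ : 0 < δ) (hgB : 0 < gB) (hgE : 0 < gE) (hRt : 0 ≤ Rt)
    (h : IsDiscretePhaseModel L R₁ R₂ P εB εE X) :
    (secrecyOutageProb P (bobSNR gB εB) (eveSNR gE δ εE X) Rt : ℂ) =
      1 - Complex.exp (-((((2 : ℝ) ^ Rt - 1 : ℝ) : ℂ) / (L * gB))) *
        (((2 / (δ * (R₂ ^ 2 - R₁ ^ 2)) * ((2 : ℝ) ^ Rt * gE / gB) ^ (2 / δ) : ℝ) : ℂ) *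
          (meijerG 1 2 ![1 + 2 / (δ : ℂ), 1] ![1 + 2 / (δ : ℂ), 0]
              ((R₂ ^ δ * gB / ((2 : ℝ) ^ Rt * gE) : ℝ) : ℂ) -
            meijerG 1 2 ![1 + 2 / (δ : ℂ), 1] ![1 + 2 / (δ : ℂ), 0]
              ((R₁ ^ δ * gB / ((2 : ℝ) ^ Rt * gE) : ℝ) : ℂ))) := by
  have hRs : (0 : ℝ) < 2 ^ Rt := by positivity
  have hset : {ω | secrecyCapacity (bobSNR gB εB) (eveSNR gE δ εE X) ω ≤ Rt} =
      {ω | bobSNR gB εB ω ≤ (2 : ℝ) ^ Rt * eveSNR gE δ εE X ω + ((2 : ℝ) ^ Rt - 1)} :=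
    Set.ext fun ω => secrecyCapacity_le_iff hRt (bobSNR_nonneg hgB _ _)
      (eveSNR_nonneg hgE _ _ _ _)
  have e : ∀ R : ℝ, R ^ δ * gB / ((2 : ℝ) ^ Rt * gE) = gB / ((2 : ℝ) ^ Rt * gE) * R ^ δ :=
    fun R => by ring
  have hW : (0 : ℝ) ≤ 2 ^ Rt - 1 := sub_nonneg.2 (Real.one_le_rpow one_le_two hRt)
  rw [secrecyOutageProb, hset, h.measureReal_bobSNR_le hL h1 h2 hδ hgB hgE hRs hW, e, e,
    Complex.ofReal_sub, Complex.ofReal_mul,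
    ofReal_two_div_mul_integral_div_one_add h1 h2 hδ (by positivity), one_div_div]
  push_cast
  rfl

theorem IsDiscretePhaseModel.secrecyOutageLowerProb_eq (hL : 1 ≤ L) (h1 : 0 < R₁) (h2 : R₁ < R₂)
    (hδ : 0 < δ) (hgB : 0 < gB) (hgE : 0 < gE) (h : IsDiscretePhaseModel L R₁ R₂ P εB εE X) :
    (secrecyOutageLowerProb P (bobSNR gB εB) (eveSNR gE δ εE X) Rt : ℂ) =
      1 - ((2 / (δ * (R₂ ^ 2 - R₁ ^ 2)) * ((2 : ℝ) ^ Rt * gE / gB) ^ (2 / δ) : ℝ) : ℂ) *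
          (meijerG 1 2 ![1 + 2 / (δ : ℂ), 1] ![1 + 2 / (δ : ℂ), 0]
              ((R₂ ^ δ * gB / ((2 : ℝ) ^ Rt * gE) : ℝ) : ℂ) -
            meijerG 1 2 ![1 + 2 / (δ : ℂ), 1] ![1 + 2 / (δ : ℂ), 0]
              ((R₁ ^ δ * gB / ((2 : ℝ) ^ Rt * gE) : ℝ) : ℂ)) := by
  have hRs : (0 : ℝ) < 2 ^ Rt := by positivity
  have hP := h.measureReal_bobSNR_le hL h1 h2 hδ hgB hgE hRs le_rfl
  have e : ∀ R : ℝ, R ^ δ * gB / ((2 : ℝ) ^ Rt * gE) = gB / ((2 : ℝ) ^ Rt * gE) * R ^ δ :=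
    fun R => by ring
  simp only [add_zero, zero_div, neg_zero, Real.exp_zero, one_mul] at hP
  rw [secrecyOutageLowerProb, hP, e, e, Complex.ofReal_sub,
    ofReal_two_div_mul_integral_div_one_add h1 h2 hδ (by positivity), one_div_div,
    Complex.ofReal_one]

theorem IsDiscretePhaseModel.nonzeroSecrecyProb_eq (hL : 1 ≤ L) (h1 : 0 < R₁) (h2 : R₁ < R₂)
    (hδ : 0 < δ) (hgB : 0 < gB) (hgE : 0 < gE) (h : IsDiscretePhaseModel L R₁ R₂ P εB εE X) :
    (nonzeroSecrecyProb P (bobSNR gB εB) (eveSNR gE δ εE X) : ℂ) =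
      1 - ((2 / (δ * (R₂ ^ 2 - R₁ ^ 2)) * (gE / gB) ^ (2 / δ) : ℝ) : ℂ) *
        (meijerG 1 2 ![2 / (δ : ℂ), 1] ![2 / (δ : ℂ), 0]
            ((R₂ ^ δ * gB / gE : ℝ) : ℂ) -
          meijerG 1 2 ![2 / (δ : ℂ), 1] ![2 / (δ : ℂ), 0]
            ((R₁ ^ δ * gB / gE : ℝ) : ℂ)) := by
  have hP := h.measureReal_bobSNR_le hL h1 h2 hδ hgB hgE one_pos le_rfl
  have e : ∀ R : ℝ, R ^ δ * gB / gE = gB / gE * R ^ δ := fun R => by ring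
  simp only [add_zero, zero_div, neg_zero, Real.exp_zero, one_mul] at hP
  have hset : {ω | 0 < secrecyCapacity (bobSNR gB εB) (eveSNR gE δ εE X) ω} =
      {ω | bobSNR gB εB ω ≤ eveSNR gE δ εE X ω}ᶜ := by
    ext ω
    simpa using secrecyCapacity_pos_iff (bobSNR_nonneg hgB εB ω) (eveSNR_nonneg hgE δ εE X ω)
  rw [nonzeroSecrecyProb, hset, probReal_compl_eq_one_sub
    (measurableSet_le (h.measurable_bobSNR gB) (h.measurable_eveSNR gE δ)), hP, sub_sub_cancel,
    ofReal_two_div_mul_integral_div_one_add_eq_one_sub h1 h2 hδ (by positivity), one_div_div, e, e]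

/-- Inclusion of events: `W ≥ 0` because `Rt ≥ 0`. -/
theorem secrecyOutageLowerProb_le_secrecyOutageProb (hgB : 0 < gB) (hgE : 0 < gE) (hRt : 0 ≤ Rt) :
    secrecyOutageLowerProb P (bobSNR gB εB) (eveSNR gE δ εE X) Rt ≤
      secrecyOutageProb P (bobSNR gB εB) (eveSNR gE δ εE X) Rt := by
  refine measureReal_mono fun ω hω => ?_
  have hω' : bobSNR gB εB ω ≤ (2 : ℝ) ^ Rt * eveSNR gE δ εE X ω := hω
  have hW : (1 : ℝ) ≤ 2 ^ Rt := Real.one_le_rpow one_le_two hRt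
  refine (secrecyCapacity_le_iff hRt (bobSNR_nonneg hgB _ _) (eveSNR_nonneg hgE _ _ _ _)).2 ?_
  linarith

end model

/-- The `G`-difference does not depend on `k`, so the SOP series is an exponential series times a
constant. -/
theorem hasSum_one_div_factorial_mul_pow_mul (x D : ℂ) :
    HasSum (fun k : ℕ => 1 / (k.factorial : ℂ) * x ^ k * D) (Complex.exp x * D) := by
  have h := NormedSpace.expSeries_div_hasSum_exp x
  rw [← Complex.exp_eq_exp_ℂ] at h
  refine (h.mul_right D).congr_fun ?_
  intro k
  ring

theorem proposition4 (L : ℕ) (hL : 1 ≤ L) (R₁ R₂ δ gB gE Rt Rs W : ℝ)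
    (hR₁ : 0 < R₁) (hR₂ : R₁ < R₂) (hδ : 0 < δ) (hgB : 0 < gB) (hgE : 0 < gE)
    (hRt : 0 ≤ Rt) (hRs : Rs = (2 : ℝ) ^ Rt) (hW : W = Rs - 1)
    {Ω : Type u} [MeasurableSpace Ω] (P : Measure Ω) [IsProbabilityMeasure P]
    (εB εE : Ω → ℂ) (X : Ω → EuclideanSpace ℝ (Fin 2))
    (hmodel : IsDiscretePhaseModel L R₁ R₂ P εB εE X) :
    -- Bob's SNR is exponential with mean `L * gB`
    P.map (bobSNR gB εB) = expMeasure (1 / (L * gB)) ∧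
    -- density of Eve's SNR
    P.map (eveSNR gE δ εE X) = volume.withDensity (fun x : ℝ => ENNReal.ofReal
      (if 0 < x then
        2 / (δ * L * gE * (R₂ ^ 2 - R₁ ^ 2)) * (L * gE / x) ^ (1 + 2 / δ) *
          (lowerGamma (1 + 2 / δ) (R₂ ^ δ / (L * gE) * x) -
            lowerGamma (1 + 2 / δ) (R₁ ^ δ / (L * gE) * x))
      else 0)) ∧
    -- distribution function of Eve's SNR
    (∀ x : ℝ, 0 < x → P.real {ω | eveSNR gE δ εE X ω ≤ x} =
      1 - 2 / (δ * (R₂ ^ 2 - R₁ ^ 2)) * (L * gE / x) ^ (2 / δ) *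
        (lowerGamma (2 / δ) (R₂ ^ δ * x / (L * gE)) -
          lowerGamma (2 / δ) (R₁ ^ δ * x / (L * gE)))) ∧
    -- the SOP
    (Summable (fun k : ℕ => (1 / (k.factorial : ℂ)) * (-((W : ℂ) / (L * gB))) ^ k *
        (meijerG 1 2 ![1 + 2 / (δ : ℂ), 1] ![1 + 2 / (δ : ℂ), 0]
            ((R₂ ^ δ * gB / (Rs * gE) : ℝ) : ℂ) -
          meijerG 1 2 ![1 + 2 / (δ : ℂ), 1] ![1 + 2 / (δ : ℂ), 0]
            ((R₁ ^ δ * gB / (Rs * gE) : ℝ) : ℂ))) ∧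
      (secrecyOutageProb P (bobSNR gB εB) (eveSNR gE δ εE X) Rt : ℂ) =
        1 - ((2 / (δ * (R₂ ^ 2 - R₁ ^ 2)) * (Rs * gE / gB) ^ (2 / δ) : ℝ) : ℂ) *
          ∑' k : ℕ, (1 / (k.factorial : ℂ)) * (-((W : ℂ) / (L * gB))) ^ k *
            (meijerG 1 2 ![1 + 2 / (δ : ℂ), 1] ![1 + 2 / (δ : ℂ), 0]
                ((R₂ ^ δ * gB / (Rs * gE) : ℝ) : ℂ) -
              meijerG 1 2 ![1 + 2 / (δ : ℂ), 1] ![1 + 2 / (δ : ℂ), 0]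
                ((R₁ ^ δ * gB / (Rs * gE) : ℝ) : ℂ))) ∧
    -- the lower bound of the SOP
    (secrecyOutageLowerProb P (bobSNR gB εB) (eveSNR gE δ εE X) Rt ≤
        secrecyOutageProb P (bobSNR gB εB) (eveSNR gE δ εE X) Rt ∧
      (secrecyOutageLowerProb P (bobSNR gB εB) (eveSNR gE δ εE X) Rt : ℂ) =
        1 - ((2 / (δ * (R₂ ^ 2 - R₁ ^ 2)) * (Rs * gE / gB) ^ (2 / δ) : ℝ) : ℂ) *
          (meijerG 1 2 ![1 + 2 / (δ : ℂ), 1] ![1 + 2 / (δ : ℂ), 0]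
              ((R₂ ^ δ * gB / (Rs * gE) : ℝ) : ℂ) -
            meijerG 1 2 ![1 + 2 / (δ : ℂ), 1] ![1 + 2 / (δ : ℂ), 0]
              ((R₁ ^ δ * gB / (Rs * gE) : ℝ) : ℂ))) ∧
    -- the PNZ
    (nonzeroSecrecyProb P (bobSNR gB εB) (eveSNR gE δ εE X) : ℂ) =
      1 - ((2 / (δ * (R₂ ^ 2 - R₁ ^ 2)) * (gE / gB) ^ (2 / δ) : ℝ) : ℂ) *
        (meijerG 1 2 ![2 / (δ : ℂ), 1] ![2 / (δ : ℂ), 0]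
            ((R₂ ^ δ * gB / gE : ℝ) : ℂ) -
          meijerG 1 2 ![2 / (δ : ℂ), 1] ![2 / (δ : ℂ), 0]
            ((R₁ ^ δ * gB / gE : ℝ) : ℂ)) ∧
    -- the lower bound and the PNZ do not depend on the number of elements
    (∀ (L' : ℕ), 1 ≤ L' → ∀ {Ω' : Type u} [MeasurableSpace Ω'] (P' : Measure Ω')
      [IsProbabilityMeasure P'] (εB' εE' : Ω' → ℂ) (X' : Ω' → EuclideanSpace ℝ (Fin 2)),
      IsDiscretePhaseModel L' R₁ R₂ P' εB' εE' X' →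
        secrecyOutageLowerProb P' (bobSNR gB εB') (eveSNR gE δ εE' X') Rt =
            secrecyOutageLowerProb P (bobSNR gB εB) (eveSNR gE δ εE X) Rt ∧
          nonzeroSecrecyProb P' (bobSNR gB εB') (eveSNR gE δ εE' X') =
            nonzeroSecrecyProb P (bobSNR gB εB) (eveSNR gE δ εE X)) := by
  subst hRs hW
  have hsum := hasSum_one_div_factorial_mul_pow_mul (-((((2 : ℝ) ^ Rt - 1 : ℝ) : ℂ) / (L * gB)))
    (meijerG 1 2 ![1 + 2 / (δ : ℂ), 1] ![1 + 2 / (δ : ℂ), 0]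
        ((R₂ ^ δ * gB / ((2 : ℝ) ^ Rt * gE) : ℝ) : ℂ) -
      meijerG 1 2 ![1 + 2 / (δ : ℂ), 1] ![1 + 2 / (δ : ℂ), 0]
        ((R₁ ^ δ * gB / ((2 : ℝ) ^ Rt * gE) : ℝ) : ℂ))
  refine ⟨hmodel.map_bobSNR hL hgB, hmodel.map_eveSNR hL hR₁ hR₂ hδ hgE,
    fun x hx => hmodel.cdf_eveSNR hL hR₁ hR₂ hδ hgE hx, ⟨hsum.summable, ?_⟩,
    ⟨secrecyOutageLowerProb_le_secrecyOutageProb hgB hgE hRt,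
      hmodel.secrecyOutageLowerProb_eq hL hR₁ hR₂ hδ hgB hgE⟩,
    hmodel.nonzeroSecrecyProb_eq hL hR₁ hR₂ hδ hgB hgE, ?_⟩
  · rw [hsum.tsum_eq, hmodel.secrecyOutageProb_eq hL hR₁ hR₂ hδ hgB hgE hRt, mul_left_comm]
  · intro L' hL' Ω' _ P' _ εB' εE' X' hmodel'
    constructor
    -- Both probabilities equal the same complex expression, in which `L` does not occur.
    · apply Complex.ofReal_injective
      rw [hmodel.secrecyOutageLowerProb_eq hL hR₁ hR₂ hδ hgB hgE,
        hmodel'.secrecyOutageLowerProb_eq hL' hR₁ hR₂ hδ hgB hgE]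
    · apply Complex.ofReal_injective
      rw [hmodel.nonzeroSecrecyProb_eq hL hR₁ hR₂ hδ hgB hgE,
        hmodel'.nonzeroSecrecyProb_eq hL' hR₁ hR₂ hδ hgB hgE]
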